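/- Let $d\ge 1$, let $\mathcal M^d$ be the space of probability measures on $\{\pm e_1,\dots,\pm e_d\}$, let $\Omega=(\mathcal M^d)^{\mathbb Z^d}$, and let $P=Q^{\mathbb Z^d}$ be an i.i.d. law on $\Omega$, where the probability measure $Q$ on $\mathcal M^d$ is uniformly elliptic: for some $\varepsilon>0$, $Q(\{q: q(e)<\varepsilon\})=0$ for every $e\in\{\pm e_i\}$. For $\omega\in\Omega$ let $P_\omega^0$ be the law of the Markov chain $(X_n)_{n\ge 0}$ on $\mathbb Z^d$ with $X_0=0$ and transition probabilities $P_\omega(X_{n+1}=z+e\mid X_n=z)=\omega(z,e)$, and let $\mathbf P=P\otimes P_\omega^0$ be the joint law of the environment and the walk. Let $\ell\in\{\pm e_1,\dots,\pm e_d\}$, let $A_\ell=\{\lim_{n\to\infty}\langle X_n,\ell\rangle=\infty\}$, and assume $\mathbf P(A_\ell)>0$. A time $t\ge 0$ is a regeneration time if $\langle X_s,\ell\rangle<\langle X_t,\ell\rangle$ for all $s<t$ and $\langle X_s,\ell\rangle>\langle X_t,\ell\rangle$ for all $s>t$; let $t_1<t_2$ be the first two regeneration times, which exist almost surely on $A_\ell$.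 Put $\mathcal K_L=\{z\in\mathbb Z^d: 0\le\langle z,\ell\rangle<L\}$. The slab between $t_1$ and $t_2$ is $(L,W,u,K)$, where $L=\langle X_{t_2}-X_{t_1},\ell\rangle$, $W:\mathcal K_L\to\mathcal M^d$ is $W(z)=\omega(z+X_{t_1})$, $u=t_2-t_1$, and $K:\{0,\dots,u\}\to\mathbb Z^d$ is $K(t)=X_{t_1+t}-X_{t_1}$. Let $\lambda$ be the law of this slab under $\mathbf P(\,\cdot\mid A_\ell)$. Let $(S_n)_{n\in\mathbb Z}=(L_n,W_n,u_n,K_n)_{n\in\mathbb Z}$ be i.i.d. with law $\lambda$. Let $Y_0=0$ and $Y_{n+1}=Y_n+K_n(u_n)$ for all $n\in\mathbb Z$. Almost surely $\mathbb Z^d$ is the disjoint union of the sets $Y_n+\mathcal K_{L_n}$; let $n(z)$ be the unique $n$ with $z\in Y_n+\mathcal K_{L_n}$. Let $\mu$ be the law on $\Omega\times\{0,1\}^{\mathbb Z^d}$ of the pair formed by the environment $z\mapsto W_{n(z)}(z-Y_{n(z)})$ and the backward path $\bigcup_{n\in\mathbb Z}\bigl(Y_n+K_n(\{0,\dots,u_n\})\bigr)\subseteq\mathbb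 Z^d$. **Proposition.** There exists a probability measure $\tilde P$ on $\Omega\times\Omega\times\{0,1\}^{\mathbb Z^d}$, the law of a triple $(\omega,\tilde\omega,\mathcal T)$, such that 1. $\omega$ is distributed according to $P$; 2. $(\tilde\omega,\mathcal T)$ is distributed according to $\mu$; 3. $\tilde P$-almost surely, $\omega(z)=\tilde\omega(z)$ for every $z\in\mathbb Z^d\setminus\mathcal T$; 4. $\omega$ and $\mathcal T$ are independent. -/

import Mathlib

open MeasureTheory ProbabilityTheory

namespace RWRE

/-! ### Environments and walks on the integer lattice -/

/-- The lattice `ℤ^d`. -/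
abbrev Site (d : ℕ) : Type := Fin d → ℤ

/-- Indices for the `2d` vectors `±e_i`: the pair `(i, s)` stands for `s e_i`. -/
abbrev Dir (d : ℕ) : Type := Fin d × ℤˣ

/-- The lattice vector `s e_i` named by the pair `(i, s)`. -/
def Dir.vec {d : ℕ} (e : Dir d) : Site d := Pi.single e.1 (e.2 : ℤ)

/-- The inner product `⟨z, ℓ⟩` of a lattice point with the unit vector `ℓ ∈ {±e_i}`. -/
def level {d : ℕ} (ℓ : Dir d) (z : Site d) : ℤ := (ℓ.2 : ℤ) * z ℓ.1

/-- The space of probability measures on the finite set `{±e_i}`, as probability vectors, with the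
Borel `σ`-algebra it has as a subset of `ℝ^{2d}`. -/
abbrev StepLaw (d : ℕ) : Type := stdSimplex ℝ (Dir d)

/-- Environments: a probability measure on `{±e_i}` at every site, with the product `σ`-algebra. -/
abbrev Env (d : ℕ) : Type := Site d → StepLaw d

/-- Infinite trajectories in `ℤ^d`, with the product `σ`-algebra. -/
abbrev Path (d : ℕ) : Type := ℕ → Site d

/-- Uniform ellipticity of a law on `StepLaw d`. -/
def UniformlyElliptic {d : ℕ} (Q : Measure (StepLaw d)) : Prop :=
  ∃ ε : ℝ, 0 < ε ∧ ∀ e : Dir d, Q {q | q.1 e < ε} = 0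

/-- The i.i.d. environment law `P = Q^{ℤ^d}`. -/
noncomputable def envLaw {d : ℕ} (Q : Measure (StepLaw d)) : Measure (Env d) :=
  Measure.infinitePi (fun _ : Site d => Q)

/-- The one-step transition kernel in the environment `ω`: from `x` to `x + e` with
probability `ω(x, e)`. -/
noncomputable def stepKernel {d : ℕ} (ω : Env d) : Kernel (Site d) (Site d) where
  toFun x := ∑ e : Dir d, ENNReal.ofReal ((ω x).1 e) • Measure.dirac (x + e.vec)
  measurable' := Measurable.of_discrete

instance {d : ℕ} (ω : Env d) : IsMarkovKernel (stepKernel ω) where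
  isProbabilityMeasure x := ⟨by
    change (∑ e : Dir d, ENNReal.ofReal ((ω x).1 e) • Measure.dirac (x + e.vec)) Set.univ = 1
    simp only [Measure.coe_finsetSum, Finset.sum_apply, Measure.smul_apply, measure_univ,
      smul_eq_mul, mul_one]
    rw [← ENNReal.ofReal_sum_of_nonneg fun e _ => (ω x).2.1 e, (ω x).2.2, ENNReal.ofReal_one]⟩

/-- The transition at time `n`, as a kernel from histories `(x_0, …, x_n)`: it only looks at the
present position `x_n`. -/
noncomputable def historyKernel {d : ℕ} (ω : Env d) (n : ℕ) :
    Kernel ((i : Finset.Iic n) → Site d) (Site d) :=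
  (stepKernel ω).comap (fun h => h ⟨n, Finset.mem_Iic.2 le_rfl⟩) (measurable_pi_apply _)

instance {d : ℕ} (ω : Env d) (n : ℕ) : IsMarkovKernel (historyKernel ω n) := by
  unfold historyKernel; infer_instance

/-- The quenched law `P_ω^z`: the law of the Markov chain with transition kernel `stepKernel ω`
started at `z`. -/
noncomputable def quenchedLaw {d : ℕ} (ω : Env d) (z : Site d) : Measure (Path d) :=
  Kernel.traj (X := fun _ => Site d) (historyKernel ω) 0 (fun _ => z)

instance {d : ℕ} (ω : Env d) (z : Site d) : IsProbabilityMeasure (quenchedLaw ω z) := by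
  unfold quenchedLaw; infer_instance

theorem measurable_stepKernel {d : ℕ} (x : Site d) {A : Set (Site d)} :
    Measurable fun ω : Env d => stepKernel ω x A := by
  have : (fun ω : Env d => stepKernel ω x A) =
      fun ω => ∑ e : Dir d, ENNReal.ofReal ((ω x).1 e) * Measure.dirac (x + e.vec) A := by
    ext ω
    change (∑ e : Dir d, ENNReal.ofReal ((ω x).1 e) • Measure.dirac (x + e.vec)) A = _
    simp [Finset.sum_apply]
  rw [this]
  refine Finset.measurable_fun_sum _ fun e _ => Measurable.mul_const ?_ _
  exact ENNReal.measurable_ofReal.comp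
    ((measurable_pi_apply e).comp (measurable_subtype_coe.comp (measurable_pi_apply x)))

theorem measurable_partialTraj {d : ℕ} (z : Site d) (n : ℕ) :
    Measurable fun ω : Env d =>
      Kernel.partialTraj (X := fun _ => Site d) (historyKernel ω) 0 n (fun _ => z) := by
  induction n with
  | zero => simp only [Kernel.partialTraj_self, Kernel.id_apply]; exact measurable_const
  | succ n ih =>
    refine Measure.measurable_of_measurable_coe _ fun A hA => ?_
    have hstep : ∀ h : (i : Finset.Iic n) → Site d, Measurable fun ω : Env d =>
        Kernel.partialTraj (X := fun _ => Site d) (historyKernel ω) n (n + 1) h A := by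
      intro h
      have key : ∀ ω : Env d,
          Kernel.partialTraj (X := fun _ => Site d) (historyKernel ω) n (n + 1) h A =
          stepKernel ω (h ⟨n, Finset.mem_Iic.2 le_rfl⟩)
            ((fun y => IicProdIoc (X := fun _ => Site d) n (n + 1)
              (h, MeasurableEquiv.piSingleton (X := fun _ => Site d) n y)) ⁻¹' A) := by
        intro ω
        have := Kernel.IsMarkovKernel.map (historyKernel ω n)
          (MeasurableEquiv.piSingleton (X := fun _ => Site d) n).measurable
        have hA' : MeasurableSet (IicProdIoc (X := fun _ => Site d) n (n + 1) ⁻¹' A) :=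
          measurable_IicProdIoc hA
        rw [Kernel.partialTraj_succ_self,
          Kernel.map_apply' (κ := Kernel.id ×ₖ (historyKernel ω n).map
            (MeasurableEquiv.piSingleton (X := fun _ => Site d) n))
            measurable_IicProdIoc _ hA,
          Kernel.prod_apply, Kernel.id_apply, Measure.dirac_prod,
          Measure.map_apply measurable_prodMk_left hA',
          Kernel.map_apply' _ (MeasurableEquiv.piSingleton (X := fun _ => Site d) n).measurable _
            (measurable_prodMk_left hA')]
        rfl
      simp_rw [key]
      exact measurable_stepKernel _
    have key : ∀ ω : Env d, Kernel.partialTraj (X := fun _ => Site d) (historyKernel ω) 0 (n + 1)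
        (fun _ => z) A = ∑' h : ((i : Finset.Iic n) → Site d),
          Kernel.partialTraj (X := fun _ => Site d) (historyKernel ω) n (n + 1) h A
          * Kernel.partialTraj (X := fun _ => Site d) (historyKernel ω) 0 n (fun _ => z) {h} := by
      intro ω
      rw [Kernel.partialTraj_succ_eq_comp (Nat.zero_le n), Kernel.comp_apply' _ _ _ hA,
        lintegral_countable']
    simp_rw [key]
    refine Measurable.tsum fun h => ?_
    exact (hstep h).mul ((Measure.measurable_coe (measurableSet_singleton h)).comp ih)

theorem measurable_quenchedLaw {d : ℕ} (z : Site d) :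
    Measurable fun ω : Env d => quenchedLaw ω z := by
  refine Measurable.measure_of_isPiSystem_of_isProbabilityMeasure
    (S := measurableCylinders fun _ : ℕ => Site d) generateFrom_measurableCylinders.symm
    isPiSystem_measurableCylinders fun t ht => ?_
  obtain ⟨N, S, mS, rfl⟩ : ∃ N S, MeasurableSet S ∧ t = cylinder (Finset.Iic N) S := by
    simpa [measurableCylinders_nat] using ht
  have key : ∀ ω : Env d, quenchedLaw ω z (cylinder (Finset.Iic N) S) =
      Kernel.partialTraj (X := fun _ => Site d) (historyKernel ω) 0 N (fun _ => z) S := by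
    intro ω
    rw [← Kernel.traj_map_frestrictLe_apply, Measure.map_apply (by fun_prop) mS]
    rfl
  simp_rw [key]
  exact (Measure.measurable_coe mS).comp (measurable_partialTraj z N)

/-- The quenched law of the walk started at the origin, as a kernel from environments. -/
noncomputable def quenchedKernel (d : ℕ) : Kernel (Env d) (Path d) :=
  ⟨fun ω => quenchedLaw ω 0, measurable_quenchedLaw 0⟩

instance (d : ℕ) : IsMarkovKernel (quenchedKernel d) :=
  ⟨fun ω => inferInstanceAs (IsProbabilityMeasure (quenchedLaw ω 0))⟩

/-- The joint law `P ⊗ P_ω^0` of the environment and the walk started at the origin. -/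
noncomputable def jointLaw {d : ℕ} (Q : Measure (StepLaw d)) : Measure (Env d × Path d) :=
  (envLaw Q).compProd (quenchedKernel d)

/-- The event `A_ℓ` that the walk is transient in the direction `ℓ`. -/
def transient {d : ℕ} (ℓ : Dir d) : Set (Env d × Path d) :=
  {p | Filter.Tendsto (fun n => level ℓ (p.2 n)) Filter.atTop Filter.atTop}

/-! ### Regeneration slabs -/

/-- `t` is a regeneration time of the trajectory `X` in the direction `ℓ`. -/
def IsRegeneration {d : ℕ} (ℓ : Dir d) (X : Path d) (t : ℕ) : Prop :=
  (∀ s < t, level ℓ (X s) < level ℓ (X t)) ∧ (∀ s > t, level ℓ (X t) < level ℓ (X s))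

/-- The `k`-th regeneration time, counted from `k = 0` (so the first one is `regTime ℓ X 0`);
it is `0` if it does not exist. -/
noncomputable def regTime {d : ℕ} (ℓ : Dir d) (X : Path d) (k : ℕ) : ℕ :=
  Nat.nth (IsRegeneration ℓ X) k

/-- The slab `𝒦_L = {z | 0 ≤ ⟨z, ℓ⟩ < L}`. -/
def slabSet {d : ℕ} (ℓ : Dir d) (L : ℤ) : Set (Site d) := {z | 0 ≤ level ℓ z ∧ level ℓ z < L}

/-- The data `(L, W, u, K)` of a regeneration slab, with the product `σ`-algebra. The functions
`W : 𝒦_L → StepLaw d` and `K : [0, u] → ℤ^d` are encoded by total functions: `W` is continued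
outside `𝒦_L` by the fixed value `placeholder ℓ`, and `K` is continued after time `u` by `K(u)`. -/
abbrev Slab (d : ℕ) : Type := ℤ × (Site d → StepLaw d) × ℕ × (ℕ → Site d)

namespace Slab

/-- The width `L`. -/
def L {d : ℕ} (S : Slab d) : ℤ := S.1

/-- The environment `W` in the slab. -/
def W {d : ℕ} (S : Slab d) : Site d → StepLaw d := S.2.1

/-- The duration `u`. -/
def u {d : ℕ} (S : Slab d) : ℕ := S.2.2.1

/-- The path `K`. -/
def K {d : ℕ} (S : Slab d) : ℕ → Site d := S.2.2.2

end Slab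

/-- The value (a point mass at `ℓ`) that is used where a slab environment is not defined. -/
def placeholder {d : ℕ} (ℓ : Dir d) : StepLaw d := ⟨Pi.single ℓ 1, single_mem_stdSimplex ℝ ℓ⟩

open Classical in
/-- The regeneration slab of `(ω, X)` between the `k`-th and the `(k+1)`-st regeneration times,
counted from `k = 0`. -/
noncomputable def slab {d : ℕ} (ℓ : Dir d) (k : ℕ) (p : Env d × Path d) : Slab d :=
  let ω := p.1
  let X := p.2
  let t := regTime ℓ X k
  let t' := regTime ℓ X (k + 1)
  let L := level ℓ (X t') - level ℓ (X t)
  (L, fun z => if z ∈ slabSet ℓ L then ω (z + X t) else placeholder ℓ,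
    t' - t, fun s => X (t + min s (t' - t)) - X t)

theorem measurable_of_countable_index {I α β : Type*} [MeasurableSpace α] [MeasurableSpace β]
    [Countable I] [MeasurableSpace I] [MeasurableSingletonClass I] {f : I → α → β}
    (hf : ∀ i, Measurable (f i)) {g : α → I} (hg : Measurable g) :
    Measurable fun a => f (g a) a :=
  (measurable_from_prod_countable_right (f := fun q : I × α => f q.1 q.2) hf).comp
    (hg.prodMk measurable_id)

theorem measurable_nat_sInf {α : Type*} [MeasurableSpace α] {A : α → Set ℕ}
    (hA : ∀ n, MeasurableSet {a | n ∈ A a}) : Measurable fun a => sInf (A a) := by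
  refine measurable_to_countable' fun n => ?_
  have : (fun a => sInf (A a)) ⁻¹' {n} = ({a | n ∈ A a} ∩ ⋂ m ∈ Set.Iio n, {a | m ∈ A a}ᶜ) ∪
      ({_a : α | n = 0} ∩ ⋂ m, {a | m ∈ A a}ᶜ) := by
    ext a
    simp only [Set.mem_preimage, Set.mem_singleton_iff, Set.mem_union, Set.mem_inter_iff,
      Set.mem_iInter, Set.mem_compl_iff, Set.mem_ofPred_eq, Set.mem_Iio]
    constructor
    · rintro rfl
      rcases (A a).eq_empty_or_nonempty with h | h
      · right; simp [h]
      · exact Or.inl ⟨Nat.sInf_mem h, fun m hm => Nat.notMem_of_lt_sInf hm⟩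
    · rintro (⟨h1, h2⟩ | ⟨rfl, h⟩)
      · refine le_antisymm (Nat.sInf_le h1) (le_of_not_gt fun hlt => ?_)
        exact h2 _ hlt (Nat.sInf_mem ⟨n, h1⟩)
      · rw [Set.eq_empty_of_forall_notMem h, Nat.sInf_empty]
  rw [this]
  exact ((hA n).inter (MeasurableSet.biInter (Set.to_countable _) fun m _ => (hA m).compl)).union
    ((MeasurableSet.const _).inter (MeasurableSet.iInter fun m => (hA m).compl))

theorem measurable_level {d : ℕ} (ℓ : Dir d) : Measurable (level (d := d) ℓ) :=
  Measurable.of_discrete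

theorem measurable_regTime {d : ℕ} (ℓ : Dir d) (k : ℕ) :
    Measurable fun X : Path d => regTime ℓ X k := by
  have hreg : ∀ t, MeasurableSet {X : Path d | IsRegeneration ℓ X t} := by
    intro t
    have hl : ∀ s, Measurable fun X : Path d => level ℓ (X s) := fun s =>
      (measurable_level ℓ).comp (measurable_pi_apply s)
    have : {X : Path d | IsRegeneration ℓ X t} =
        (⋂ s ∈ Set.Iio t, {X | level ℓ (X s) < level ℓ (X t)}) ∩
        (⋂ s ∈ Set.Ioi t, {X | level ℓ (X t) < level ℓ (X s)}) := by
      ext X; simp [IsRegeneration]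
    rw [this]
    exact (MeasurableSet.biInter (Set.to_countable _) fun s _ =>
        measurableSet_lt (hl s) (hl t)).inter
      (MeasurableSet.biInter (Set.to_countable _) fun s _ => measurableSet_lt (hl t) (hl s))
  induction k using Nat.strong_induction_on with
  | _ k ih =>
    unfold regTime
    have h : (fun X : Path d => Nat.nth (IsRegeneration ℓ X) k) = fun X => sInf
        {x | IsRegeneration ℓ X x ∧ ∀ j < k, Nat.nth (IsRegeneration ℓ X) j < x} :=
      funext fun X => Nat.nth_eq_sInf _ _
    rw [h]
    refine measurable_nat_sInf fun n => ?_
    have : {X : Path d | n ∈ {x | IsRegeneration ℓ X x ∧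
        ∀ j < k, Nat.nth (IsRegeneration ℓ X) j < x}} =
        {X | IsRegeneration ℓ X n} ∩ ⋂ j ∈ Set.Iio k, {X | regTime ℓ X j < n} := by
      ext X; simp [regTime]
    rw [this]
    exact (hreg n).inter (MeasurableSet.biInter (Set.to_countable _) fun j hj =>
      measurableSet_lt (ih j hj) measurable_const)

theorem measurable_slab {d : ℕ} (ℓ : Dir d) (k : ℕ) : Measurable (slab (d := d) ℓ k) := by
  have hT : ∀ k, Measurable fun p : Env d × Path d => regTime ℓ p.2 k := fun k =>
    (measurable_regTime ℓ k).comp measurable_snd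
  have hX : ∀ {g : Env d × Path d → ℕ}, Measurable g →
      Measurable fun p : Env d × Path d => p.2 (g p) :=
    fun hg => measurable_of_countable_index (f := fun n (p : Env d × Path d) => p.2 n)
      (fun n => (measurable_pi_apply n).comp measurable_snd) hg
  have hL : Measurable fun p : Env d × Path d =>
      level ℓ (p.2 (regTime ℓ p.2 (k + 1))) - level ℓ (p.2 (regTime ℓ p.2 k)) :=
    ((measurable_level ℓ).comp (hX (hT _))).sub ((measurable_level ℓ).comp (hX (hT _)))
  have hu : Measurable fun p : Env d × Path d => regTime ℓ p.2 (k + 1) - regTime ℓ p.2 k :=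
    (hT _).sub (hT _)
  refine hL.prodMk (Measurable.prodMk ?_ (hu.prodMk ?_))
  · refine measurable_pi_iff.2 fun z => Measurable.ite ?_ ?_ measurable_const
    · exact hL (t := {L : ℤ | z ∈ slabSet ℓ L}) (MeasurableSet.of_discrete)
    · exact measurable_of_countable_index (f := fun y (p : Env d × Path d) => p.1 y)
        (fun y => (measurable_pi_apply y).comp measurable_fst) ((hX (hT k)).const_add z)
  · refine measurable_pi_iff.2 fun s => ?_
    exact (hX ((hT k).add (measurable_const.min hu))).sub (hX (hT k))

/-- The law `λ` of the slab between the first two regeneration times, conditioned on transience in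
the direction `ℓ`. -/
noncomputable def slabLaw {d : ℕ} (Q : Measure (StepLaw d)) (ℓ : Dir d) : Measure (Slab d) :=
  ((jointLaw Q)[|transient ℓ]).map (slab ℓ 0)

/-! ### The backward path -/

/-- The points `Y_n`, with `Y_0 = 0` and `Y_{n+1} = Y_n + K_n(u_n)` for all `n ∈ ℤ`. -/
noncomputable def anchor {d : ℕ} (S : ℤ → Slab d) (n : ℤ) : Site d :=
  ∑ i ∈ Finset.Ico 0 n, (S i).K (S i).u - ∑ i ∈ Finset.Ico n 0, (S i).K (S i).u

theorem anchor_zero {d : ℕ} (S : ℤ → Slab d) : anchor S 0 = 0 := by simp [anchor]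

theorem anchor_add_one {d : ℕ} (S : ℤ → Slab d) (n : ℤ) :
    anchor S (n + 1) = anchor S n + (S n).K (S n).u := by
  unfold anchor
  rcases le_or_gt 0 n with h | h
  · have h1 : Finset.Ico 0 (n + 1) = insert n (Finset.Ico 0 n) := by
      ext x; simp only [Finset.mem_Ico, Finset.mem_insert]; omega
    have h2 : Finset.Ico (n + 1) 0 = ∅ := Finset.Ico_eq_empty (by omega)
    have h3 : Finset.Ico n 0 = ∅ := Finset.Ico_eq_empty (by omega)
    rw [h1, h2, h3, Finset.sum_insert (by simp)]
    simp [add_comm]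
  · have h1 : Finset.Ico n 0 = insert n (Finset.Ico (n + 1) 0) := by
      ext x; simp only [Finset.mem_Ico, Finset.mem_insert]; omega
    have h2 : Finset.Ico 0 (n + 1) = ∅ := Finset.Ico_eq_empty (by omega)
    have h3 : Finset.Ico 0 n = ∅ := Finset.Ico_eq_empty (by omega)
    rw [h1, h2, h3, Finset.sum_insert (by simp)]
    simp

/-- `z` lies in the `n`-th glued slab `Y_n + 𝒦_{L_n}`. -/
def InSlab {d : ℕ} (ℓ : Dir d) (S : ℤ → Slab d) (z : Site d) (n : ℤ) : Prop :=
  z - anchor S n ∈ slabSet ℓ (S n).L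

open Classical in
/-- The unique `n = n(z)` such that `z` lies in `Y_n + 𝒦_{L_n}` (and `0` if there is none). -/
noncomputable def slabIndex {d : ℕ} (ℓ : Dir d) (S : ℤ → Slab d) (z : Site d) : ℤ :=
  if h : ∃! n : ℤ, InSlab ℓ S z n then h.choose else 0

open Classical in
/-- The glued environment `ω(z) = W_{n(z)}(z - Y_{n(z)})` (with a fixed value at `z` if there is
no unique `n` such that `z` lies in `Y_n + 𝒦_{L_n}`). -/
noncomputable def gluedEnv {d : ℕ} (ℓ : Dir d) (S : ℤ → Slab d) : Env d := fun z =>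
  if ∃! n : ℤ, InSlab ℓ S z n then
    (S (slabIndex ℓ S z)).W (z - anchor S (slabIndex ℓ S z))
  else placeholder ℓ

/-- The glued path `𝒯 = ⋃_n (Y_n + K_n[0, u_n])`, as a random subset of `ℤ^d`. -/
noncomputable def gluedPath {d : ℕ} (S : ℤ → Slab d) : Set (Site d) :=
  ⋃ n : ℤ, (fun t => anchor S n + (S n).K t) '' Set.Icc 0 (S n).u

theorem measurable_K {d : ℕ} {g : (ℤ → Slab d) → ℕ} (hg : Measurable g) (n : ℤ) :
    Measurable fun S : ℤ → Slab d => (S n).K (g S) :=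
  measurable_of_countable_index (f := fun t (S : ℤ → Slab d) => (S n).K t)
    (fun t => (measurable_pi_apply t).comp
      ((measurable_snd.comp (measurable_snd.comp measurable_snd)).comp (measurable_pi_apply n))) hg

theorem measurable_u {d : ℕ} (n : ℤ) : Measurable fun S : ℤ → Slab d => (S n).u :=
  (measurable_fst.comp (measurable_snd.comp measurable_snd)).comp (measurable_pi_apply n)

theorem measurable_anchor {d : ℕ} (n : ℤ) : Measurable fun S : ℤ → Slab d => anchor S n :=
  (Finset.measurable_fun_sum _ fun i _ => measurable_K (measurable_u i) i).sub
    (Finset.measurable_fun_sum _ fun i _ => measurable_K (measurable_u i) i)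

theorem measurableSet_inSlab {d : ℕ} (ℓ : Dir d) (z : Site d) (n : ℤ) :
    MeasurableSet {S : ℤ → Slab d | InSlab ℓ S z n} := by
  have h : Measurable fun S : ℤ → Slab d => (z - anchor S n, (S n).L) :=
    ((measurable_anchor n).const_sub z).prodMk (measurable_fst.comp (measurable_pi_apply n))
  exact h (t := {q : Site d × ℤ | q.1 ∈ slabSet ℓ q.2}) MeasurableSet.of_discrete

theorem measurableSet_existsUnique_inSlab {d : ℕ} (ℓ : Dir d) (z : Site d) :
    MeasurableSet {S : ℤ → Slab d | ∃! n : ℤ, InSlab ℓ S z n} := by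
  have : {S : ℤ → Slab d | ∃! n : ℤ, InSlab ℓ S z n} = ⋃ n : ℤ, ({S | InSlab ℓ S z n} ∩
      ⋂ m ∈ ({n}ᶜ : Set ℤ), {S | InSlab ℓ S z m}ᶜ) := by
    ext S
    simp only [ExistsUnique, Set.mem_ofPred_eq, Set.mem_iUnion, Set.mem_inter_iff, Set.mem_iInter,
      Set.mem_compl_iff, Set.mem_singleton_iff]
    exact exists_congr fun n => and_congr_right fun _ => forall_congr' fun m => by tauto
  rw [this]
  exact MeasurableSet.iUnion fun n => (measurableSet_inSlab ℓ z n).inter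
    (MeasurableSet.biInter (Set.to_countable _) fun m _ => (measurableSet_inSlab ℓ z m).compl)

theorem measurable_slabIndex {d : ℕ} (ℓ : Dir d) (z : Site d) :
    Measurable fun S : ℤ → Slab d => slabIndex ℓ S z := by
  classical
  refine measurable_to_countable' fun n => ?_
  have : (fun S : ℤ → Slab d => slabIndex ℓ S z) ⁻¹' {n} =
      ({S | ∃! n : ℤ, InSlab ℓ S z n} ∩ {S | InSlab ℓ S z n}) ∪
      ({S | ∃! n : ℤ, InSlab ℓ S z n}ᶜ ∩ {_S | n = 0}) := by
    ext S
    simp only [Set.mem_preimage, Set.mem_singleton_iff, Set.mem_union, Set.mem_inter_iff,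
      Set.mem_compl_iff, Set.mem_ofPred_eq, slabIndex]
    split_ifs with h
    · constructor
      · rintro rfl; exact Or.inl ⟨h, h.choose_spec.1⟩
      · rintro (⟨-, h1⟩ | ⟨h1, -⟩)
        · exact (h.choose_spec.2 n h1).symm
        · exact absurd h h1
    · constructor
      · rintro rfl; exact Or.inr ⟨h, rfl⟩
      · rintro (⟨h1, -⟩ | ⟨-, h1⟩)
        · exact absurd h1 h
        · exact h1.symm
  rw [this]
  exact ((measurableSet_existsUnique_inSlab ℓ z).inter (measurableSet_inSlab ℓ z n)).union
    ((measurableSet_existsUnique_inSlab ℓ z).compl.inter (MeasurableSet.const _))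

theorem measurable_gluedEnv {d : ℕ} (ℓ : Dir d) : Measurable (gluedEnv (d := d) ℓ) := by
  refine measurable_pi_iff.2 fun z => Measurable.ite (measurableSet_existsUnique_inSlab ℓ z) ?_
    measurable_const
  refine measurable_of_countable_index
    (f := fun n (S : ℤ → Slab d) => (S n).W (z - anchor S n)) (fun n => ?_)
    (measurable_slabIndex ℓ z)
  refine measurable_of_countable_index (f := fun y (S : ℤ → Slab d) => (S n).W y) (fun y => ?_)
    ((measurable_anchor n).const_sub z)
  exact (measurable_pi_apply y).comp
    ((measurable_fst.comp measurable_snd).comp (measurable_pi_apply n))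

theorem measurable_gluedPath {d : ℕ} : Measurable (gluedPath (d := d)) := by
  refine measurable_set_iff.2 fun z => measurableSet_setOfPred.1 ?_
  have : {S : ℤ → Slab d | z ∈ gluedPath S} =
      ⋃ n : ℤ, ⋃ t : ℕ, ({S | t ≤ (S n).u} ∩ {S | anchor S n + (S n).K t = z}) := by
    ext S; simp [gluedPath]
  rw [this]
  refine MeasurableSet.iUnion fun n => MeasurableSet.iUnion fun t => ?_
  exact (measurableSet_le measurable_const (measurable_u n)).inter
    (((measurable_anchor n).add (measurable_K measurable_const n)) (measurableSet_singleton z))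

/-- The law `μ` of the pair (glued environment, backward path in direction `ℓ`), for an i.i.d.
sequence `(S_n)_{n ∈ ℤ}` of slabs with law `λ`. Subsets of `ℤ^d` carry the product `σ`-algebra of
`{0, 1}^{ℤ^d}`. -/
noncomputable def backwardPathLaw {d : ℕ} (Q : Measure (StepLaw d)) (ℓ : Dir d) :
    Measure (Env d × Set (Site d)) :=
  (Measure.infinitePi (fun _ : ℤ => slabLaw Q ℓ)).map fun S => (gluedEnv ℓ S, gluedPath S)

instance {d : ℕ} (Q : Measure (StepLaw d)) [IsProbabilityMeasure Q] :
    IsProbabilityMeasure (jointLaw Q) := by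
  unfold jointLaw envLaw; infer_instance

theorem isProbabilityMeasure_slabLaw {d : ℕ} (Q : Measure (StepLaw d)) [IsProbabilityMeasure Q]
    (ℓ : Dir d) (h : 0 < jointLaw Q (transient ℓ)) : IsProbabilityMeasure (slabLaw Q ℓ) := by
  have := cond_isProbabilityMeasure h.ne'
  exact Measure.isProbabilityMeasure_map (measurable_slab ℓ 0).aemeasurable

theorem isProbabilityMeasure_backwardPathLaw {d : ℕ} (Q : Measure (StepLaw d))
    [IsProbabilityMeasure Q] (ℓ : Dir d) (h : 0 < jointLaw Q (transient ℓ)) :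
    IsProbabilityMeasure (backwardPathLaw Q ℓ) := by
  have := isProbabilityMeasure_slabLaw Q ℓ h
  exact Measure.isProbabilityMeasure_map
    ((measurable_gluedEnv ℓ).prodMk measurable_gluedPath).aemeasurable

end RWRE

namespace RWRE

/-! ### Infinite products of probability measures -/

section Product

variable {ι κ E F : Type*} [MeasurableSpace E] [MeasurableSpace F]

/-! The environment of a slab is biased only along the walk's path. Fix the first two regeneration
times and the path up to the second one. The walk never visits a site of the slab off this path: it
is below the slab before the first time, on the path between the two, and above the slab afterwards.
So the quenched probability of the event, transience included, does not depend on the environment at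
these sites (`quenchedLaw_congr`), and there the environment is still i.i.d. Keeping it off the path
and putting a fresh i.i.d. environment everywhere else (`resample`) gives a full i.i.d. environment,
independent of the width, duration and path of the slab (`measurePreserving_resample`).

Resample all slabs of the i.i.d. sequence independently and glue the results in the same geometry as
the original slabs. For a fixed geometry, distinct sites read distinct coordinates of an i.i.d.
family, so the glued environment has law `P` whatever the geometry is (`measurePreserving_glue`). It
is therefore independent of the geometry, and in particular of the backward path. Resampling changes
a slab's own environment only on its path, so the two glued environments agree off the backward
path.

The slabs must be genuine and must tile the lattice, which requires regeneration times to exist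
(`ae_exists_isRegeneration`). At each record, the conditional probability of regenerating given the
past is one constant `q`, because the past and the future read disjoint half-spaces. Transience with
positive probability forces `q > 0`. A transient walk has infinitely many records, so by Lévy's
upward theorem it cannot stop regenerating. -/

theorem measurePreserving_comp_injective (Q : Measure E) [IsProbabilityMeasure Q] {f : ι → κ}
    (hf : Function.Injective f) :
    MeasurePreserving (fun (x : κ → E) i => x (f i)) (Measure.infinitePi fun _ : κ => Q)
      (Measure.infinitePi fun _ : ι => Q) := by
  classical
  refine ⟨by fun_prop, Measure.eq_infinitePi _ fun s t ht => ?_⟩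
  -- `Function.invFun` below needs a nonempty domain.
  rcases isEmpty_or_nonempty ι with hι | hι
  · have : s = ∅ := Finset.eq_empty_of_isEmpty s
    subst this
    rw [Measure.map_apply (by fun_prop) (MeasurableSet.pi (Finset.countable_toSet _) fun i _ => ht i)]
    simp
  rw [Measure.map_apply (by fun_prop) (MeasurableSet.pi (Finset.countable_toSet _) fun i _ => ht i)]
  have : (fun (x : κ → E) i => x (f i)) ⁻¹' ((s : Set ι).pi t) =
      ((s.map ⟨f, hf⟩ : Finset κ) : Set κ).pi (fun k => t (Function.invFun f k)) := by
    ext x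
    simp [Set.mem_pi, Function.leftInverse_invFun hf _]
  rw [this, Measure.infinitePi_pi _ fun _ _ => ht _, Finset.prod_map]
  simp [Function.leftInverse_invFun hf _]

theorem measurePreserving_infinitePi {μ : Measure E} {ν : Measure F} [IsProbabilityMeasure μ]
    [IsProbabilityMeasure ν] {f : E → F} (hf : MeasurePreserving f μ ν) :
    MeasurePreserving (fun (x : ι → E) i => f (x i)) (Measure.infinitePi fun _ : ι => μ)
      (Measure.infinitePi fun _ : ι => ν) := by
  obtain rfl := hf.map_eq
  exact ⟨measurable_pi_iff.2 fun i => hf.measurable.comp (measurable_pi_apply i),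
    Measure.infinitePi_map_pi (fun _ : ι => μ) fun _ => hf.measurable⟩

/-- A box constrains finitely many coordinates, so the claim reduces to the same rearrangement of a
finite product. Pairing coordinates lets maps that mix two independent families be treated site by
site. -/
theorem measurePreserving_zip (μ : Measure E) (ν : Measure F) [IsProbabilityMeasure μ]
    [IsProbabilityMeasure ν] :
    MeasurePreserving (fun (p : (ι → E) × (ι → F)) i => (p.1 i, p.2 i))
      ((Measure.infinitePi fun _ : ι => μ).prod (Measure.infinitePi fun _ : ι => ν))
      (Measure.infinitePi fun _ : ι => μ.prod ν) := by
  have hm : Measurable fun (p : (ι → E) × (ι → F)) i => (p.1 i, p.2 i) := by fun_prop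
  refine ⟨hm, Measure.eq_infinitePi _ fun s t ht => ?_⟩
  rw [Measure.map_apply hm (MeasurableSet.pi (Finset.countable_toSet _) fun i _ => ht i)]
  have h1 : (fun (p : (ι → E) × (ι → F)) i => (p.1 i, p.2 i)) ⁻¹' ((s : Set ι).pi t) =
      Prod.map s.restrict s.restrict ⁻¹' ((MeasurableEquiv.arrowProdEquivProdArrow E F s).symm ⁻¹'
        (Set.univ.pi fun i : s => t i)) := by
    ext p
    simp [Set.mem_pi, MeasurableEquiv.arrowProdEquivProdArrow, Equiv.arrowProdEquivProdArrow]
  have hs : MeasurableSet (Set.univ.pi fun i : s => t i) := MeasurableSet.univ_pi fun i => ht _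
  have h2 : Measurable (s.restrict (π := fun _ : ι => E)) := by fun_prop
  have h3 : Measurable (s.restrict (π := fun _ : ι => F)) := by fun_prop
  rw [h1, ← Measure.map_apply (h2.prodMap h3)
    ((MeasurableEquiv.measurable _) hs), ← Measure.map_prod_map _ _ h2 h3,
    Measure.infinitePi_map_restrict, Measure.infinitePi_map_restrict,
    ← (measurePreserving_arrowProdEquivProdArrow E F s (fun _ => μ) fun _ => ν).map_eq,
    MeasurableEquiv.map_apply, ← Set.preimage_comp, MeasurableEquiv.symm_comp_self,
    Set.preimage_id, Measure.pi_pi]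
  exact Finset.prod_coe_sort s fun i => (μ.prod ν) (t i)

open Classical in
theorem measurable_piecewise_pair (U : Set ι) :
    Measurable fun p : (ι → E) × (ι → E) => U.piecewise p.1 p.2 := by
  refine measurable_pi_iff.2 fun i => ?_
  by_cases h : i ∈ U
  · simp only [h, Set.piecewise_eq_of_mem]; fun_prop
  · simp only [h, not_false_eq_true, Set.piecewise_eq_of_notMem]; fun_prop

open Classical in
/-- Exchanging two independent copies of an i.i.d. family outside of `U` preserves their law. -/
theorem measurePreserving_piecewise (Q : Measure E) [IsProbabilityMeasure Q] (U : Set ι) :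
    MeasurePreserving
      (fun p : (ι → E) × (ι → E) => (U.piecewise p.1 p.2, U.piecewise p.2 p.1))
      ((Measure.infinitePi fun _ : ι => Q).prod (Measure.infinitePi fun _ : ι => Q))
      ((Measure.infinitePi fun _ : ι => Q).prod (Measure.infinitePi fun _ : ι => Q)) := by
  let P := Measure.infinitePi fun _ : ι => Q
  have hz := measurePreserving_zip (ι := ι) Q Q
  -- On the family of pairs the exchange acts in each coordinate separately, and both the identity
  -- and the swap preserve `Q.prod Q`.
  let f : ι → E × E → E × E := fun i => if i ∈ U then id else Prod.swap
  have hf : ∀ i, MeasurePreserving (f i) (Q.prod Q) (Q.prod Q) := by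
    intro i
    by_cases h : i ∈ U
    · simpa [f, h] using MeasurePreserving.id _
    · simpa [f, h] using Measure.measurePreserving_swap
  have hp : (Measure.infinitePi fun _ : ι => Q.prod Q).map (fun x i => f i (x i)) =
      Measure.infinitePi fun _ : ι => Q.prod Q := by
    rw [Measure.infinitePi_map_pi _ fun i => (hf i).measurable]
    simp [(hf _).map_eq]
  have hfm : Measurable fun (x : ι → E × E) i => f i (x i) :=
    measurable_pi_iff.2 fun i => (hf i).measurable.comp (measurable_pi_apply i)
  let g : (ι → E × E) → (ι → E) × (ι → E) := fun x => (fun i => (x i).1, fun i => (x i).2)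
  have hg : Measurable g := by fun_prop
  have hgz : (Measure.infinitePi fun _ : ι => Q.prod Q).map g = P.prod P := by
    rw [← hz.map_eq, Measure.map_map hg hz.measurable]
    exact Measure.map_id
  refine ⟨(measurable_piecewise_pair U).prodMk
    ((measurable_piecewise_pair U).comp measurable_swap), ?_⟩
  have : (fun p : (ι → E) × (ι → E) => (U.piecewise p.1 p.2, U.piecewise p.2 p.1)) =
      g ∘ (fun x i => f i (x i)) ∘ fun p i => (p.1 i, p.2 i) := by
    funext p
    refine Prod.ext (funext fun i => ?_) (funext fun i => ?_) <;>
      by_cases h : i ∈ U <;> simp [g, f, h]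
  rw [this, ← Measure.map_map hg (hfm.comp hz.measurable), ← Measure.map_map hfm hz.measurable,
    hz.map_eq, hp, hgz]

/-- Functionals of disjoint sets of coordinates are independent under a product measure. -/
theorem lintegral_mul_of_eqOn (Q : Measure E) [IsProbabilityMeasure Q] (U : Set ι)
    {f g : (ι → E) → ENNReal} (hf : Measurable f) (hg : Measurable g)
    (hfU : ∀ x y, Set.EqOn x y Uᶜ → f x = f y) (hgU : ∀ x y, Set.EqOn x y U → g x = g y) :
    ∫⁻ x, f x * g x ∂(Measure.infinitePi fun _ : ι => Q) =
      (∫⁻ x, f x ∂(Measure.infinitePi fun _ : ι => Q)) *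
        ∫⁻ x, g x ∂(Measure.infinitePi fun _ : ι => Q) := by
  classical
  set P := Measure.infinitePi fun _ : ι => Q with hP
  have hm : Measurable fun p : (ι → E) × (ι → E) => f p.2 * g p.1 :=
    (hf.comp measurable_snd).mul (hg.comp measurable_fst)
  calc ∫⁻ x, f x * g x ∂P = ∫⁻ p, f p.1 * g p.1 ∂(P.prod P) := by
        rw [lintegral_prod (fun p : (ι → E) × (ι → E) => f p.1 * g p.1)
          (((hf.comp measurable_fst).mul (hg.comp measurable_fst)).aemeasurable)]
        simp
    -- `f` ignores `U` and `g` ignores its complement, so their arguments can be completed to the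
    -- two components of the exchange map.
    _ = ∫⁻ p, f (U.piecewise p.2 p.1) * g (U.piecewise p.1 p.2) ∂(P.prod P) := by
        refine lintegral_congr fun p => ?_
        rw [hfU p.1 (U.piecewise p.2 p.1) fun i hi => by
            simp [Set.piecewise_eq_of_notMem _ _ _ hi],
          hgU p.1 (U.piecewise p.1 p.2) fun i hi => by simp [Set.piecewise_eq_of_mem _ _ _ hi]]
    _ = ∫⁻ p, f p.2 * g p.1 ∂(P.prod P) :=
        (measurePreserving_piecewise Q U).lintegral_comp hm
    _ = _ := by
        rw [lintegral_prod _ hm.aemeasurable]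
        simp only
        simp_rw [lintegral_mul_const _ hf]
        rw [lintegral_const_mul _ hg]

end Product


/-! ### The quenched walk -/

section Quenched

variable {d : ℕ}

/-- The trajectories that agree with `h` up to time `n`. -/
def cyl (n : ℕ) (h : Path d) : Set (Path d) := {X | ∀ i ≤ n, X i = h i}

/-- The restriction of a trajectory to the times up to `n`. -/
abbrev past (n : ℕ) : Path d → (Finset.Iic n → Site d) :=
  Preorder.frestrictLe (π := fun _ : ℕ => Site d) n

theorem cyl_eq_preimage (n : ℕ) (h : Path d) :
    cyl n h = past n ⁻¹' {past n h} := by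
  ext X
  simp [cyl, funext_iff, Preorder.frestrictLe]

theorem measurableSet_cyl (n : ℕ) (h : Path d) : MeasurableSet (cyl n h) := by
  rw [cyl_eq_preimage]
  exact (Preorder.measurable_frestrictLe n) (measurableSet_singleton _)

theorem frestrictLe_surjective (n : ℕ) :
    Function.Surjective (past (d := d) n) := by
  intro g
  refine ⟨fun i => if hi : i ≤ n then g ⟨i, Finset.mem_Iic.2 hi⟩ else 0, ?_⟩
  ext i
  have := Finset.mem_Iic.1 i.2
  simp [this]

/-- There are only countably many histories up to time `n`, so an event of the past is a countable
union of cylinders. -/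
theorem measure_frestrictLe_preimage_congr {μ ν : Measure (Path d)} (n : ℕ)
    {B : Set ((i : Finset.Iic n) → Site d)}
    (H : ∀ h, past n h ∈ B → μ (cyl n h) = ν (cyl n h)) :
    μ (past n ⁻¹' B) = ν (past n ⁻¹' B) := by
  have hm := Preorder.measurable_frestrictLe (X := fun _ : ℕ => Site d) n
  have hB : MeasurableSet B := MeasurableSet.of_discrete
  rw [← Measure.map_apply hm hB, ← Measure.map_apply hm hB,
    ← Measure.tsum_indicator_apply_singleton _ B hB,
    ← Measure.tsum_indicator_apply_singleton _ B hB]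
  refine tsum_congr fun g => ?_
  obtain ⟨h, rfl⟩ := frestrictLe_surjective n g
  by_cases hg : past n h ∈ B
  · rw [Set.indicator_of_mem hg, Set.indicator_of_mem hg,
      Measure.map_apply hm (measurableSet_singleton _),
      Measure.map_apply hm (measurableSet_singleton _), ← cyl_eq_preimage, H h hg]
  · rw [Set.indicator_of_notMem hg, Set.indicator_of_notMem hg]

theorem path_measure_ext {μ ν : Measure (Path d)} [IsFiniteMeasure μ]
    (H : ∀ n h, μ (cyl n h) = ν (cyl n h)) : μ = ν := by
  refine ext_of_generate_finite (measurableCylinders fun _ : ℕ => Site d)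
    generateFrom_measurableCylinders.symm isPiSystem_measurableCylinders (fun t ht => ?_) ?_
  · obtain ⟨N, S, mS, rfl⟩ : ∃ N S, MeasurableSet S ∧ t = cylinder (Finset.Iic N) S := by
      simpa [measurableCylinders_nat] using ht
    exact measure_frestrictLe_preimage_congr (B := S) N fun h _ => H N h
  · exact measure_frestrictLe_preimage_congr (B := Set.univ) 0 fun h _ => H 0 h

/-- The probability that the walk in the environment `ω` follows the first `n` steps of `h`. -/
noncomputable def weight (ω : Env d) (h : Path d) (n : ℕ) : ENNReal :=
  ∏ i ∈ Finset.range n, stepKernel ω (h i) {h (i + 1)}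

theorem partialTraj_succ_singleton (ω : Env d) (n : ℕ) (g : (i : Finset.Iic n) → Site d)
    (h : Path d) :
    Kernel.partialTraj (X := fun _ => Site d) (historyKernel ω) n (n + 1) g
        {past (n + 1) h} =
      open Classical in if g = past n h then stepKernel ω (h n) {h (n + 1)}
        else 0 := by
  have := Kernel.IsMarkovKernel.map (historyKernel ω n)
    (MeasurableEquiv.piSingleton (X := fun _ => Site d) n).measurable
  have hA : MeasurableSet {past (n + 1) h} :=
    measurableSet_singleton _
  have hA' := (measurable_IicProdIoc (X := fun _ : ℕ => Site d) (m := n) (n := n + 1)) hA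
  rw [Kernel.partialTraj_succ_self,
    Kernel.map_apply' (κ := Kernel.id ×ₖ (historyKernel ω n).map
      (MeasurableEquiv.piSingleton (X := fun _ => Site d) n))
      measurable_IicProdIoc _ hA,
    Kernel.prod_apply, Kernel.id_apply, Measure.dirac_prod,
    Measure.map_apply measurable_prodMk_left hA',
    Kernel.map_apply' _ (MeasurableEquiv.piSingleton (X := fun _ => Site d) n).measurable _
      (measurable_prodMk_left hA')]
  have key : ∀ y : Site d, IicProdIoc (X := fun _ : ℕ => Site d) n (n + 1)
      (g, MeasurableEquiv.piSingleton (X := fun _ => Site d) n y) =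
        past (n + 1) h ↔ g = past n h ∧ y = h (n + 1) := by
    intro y
    constructor
    · intro H
      refine ⟨funext fun i => ?_, ?_⟩
      · have hi := Finset.mem_Iic.1 i.2
        have := congrFun H ⟨i, Finset.mem_Iic.2 (by omega)⟩
        simpa [IicProdIoc, hi, Preorder.frestrictLe] using this
      · have := congrFun H ⟨n + 1, Finset.mem_Iic.2 le_rfl⟩
        simpa [IicProdIoc, MeasurableEquiv.piSingleton, Preorder.frestrictLe] using this
    · rintro ⟨rfl, rfl⟩
      refine funext fun i => ?_
      have hi := Finset.mem_Iic.1 i.2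
      by_cases hin : (i : ℕ) ≤ n
      · simp [IicProdIoc, hin]
      · obtain ⟨i, hi'⟩ := i
        obtain rfl : i = n + 1 := by simp at hi hin; omega
        simp [IicProdIoc, MeasurableEquiv.piSingleton]
  have hpre : (MeasurableEquiv.piSingleton (X := fun _ : ℕ => Site d) n) ⁻¹'
      (Prod.mk g ⁻¹' (IicProdIoc (X := fun _ : ℕ => Site d) n (n + 1) ⁻¹'
        {past (n + 1) h})) =
      {y | g = past n h ∧ y = h (n + 1)} := by
    ext y
    simp [← key]
  rw [hpre]
  split_ifs with hg
  · subst hg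
    simp only [true_and]
    rfl
  · simp [hg]

/-- The explicit path weights through which locality, translation covariance and the Markov property
are checked. In the induction only the history of `h` itself contributes to the sum over histories.
-/
theorem quenchedLaw_cyl (ω : Env d) (z : Site d) (n : ℕ) (h : Path d) :
    quenchedLaw ω z (cyl n h) = if h 0 = z then weight ω h n else 0 := by
  have h0 : quenchedLaw ω z (cyl n h) =
      Kernel.partialTraj (X := fun _ => Site d) (historyKernel ω) 0 n (fun _ => z)
        {past n h} := by
    rw [← Kernel.traj_map_frestrictLe_apply, Measure.map_apply (by fun_prop)
      (measurableSet_singleton _), cyl_eq_preimage]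
    rfl
  rw [h0]
  clear h0
  induction n with
  | zero =>
    rw [Kernel.partialTraj_self, Kernel.id_apply, Measure.dirac_apply' _ (measurableSet_singleton _)]
    by_cases hz : h 0 = z
    · rw [if_pos hz, Set.indicator_of_mem]
      · simp [weight]
      · refine funext fun i => ?_
        obtain ⟨i, hi⟩ := i
        obtain rfl : i = 0 := by simpa using hi
        simp [hz]
    · rw [if_neg hz, Set.indicator_of_notMem]
      intro H
      exact hz (congrFun H ⟨0, by simp⟩).symm
  | succ n ih =>
    rw [Kernel.partialTraj_succ_eq_comp (Nat.zero_le n),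
      Kernel.comp_apply' _ _ _ (measurableSet_singleton _), lintegral_countable',
      tsum_eq_single (past n h), ih, partialTraj_succ_singleton, if_pos rfl]
    · split_ifs
      · rw [weight, weight, Finset.prod_range_succ, mul_comm]
      · simp
    · intro g hg
      rw [partialTraj_succ_singleton, if_neg hg, zero_mul]

theorem stepKernel_congr {ω ω' : Env d} {x : Site d} (h : ω x = ω' x) :
    stepKernel ω x = stepKernel ω' x := by
  change (∑ e : Dir d, ENNReal.ofReal ((ω x).1 e) • Measure.dirac (x + e.vec)) =
    ∑ e : Dir d, ENNReal.ofReal ((ω' x).1 e) • Measure.dirac (x + e.vec)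
  rw [h]

theorem weight_congr {ω ω' : Env d} {h : Path d} {n : ℕ} (H : ∀ i < n, ω (h i) = ω' (h i)) :
    weight ω h n = weight ω' h n :=
  Finset.prod_congr rfl fun i hi => by rw [stepKernel_congr (H i (Finset.mem_range.1 hi))]

/-- The probability of an event on which the walk avoids `U` does not depend on the environment
in `U`. -/
theorem quenchedLaw_congr {ω ω' : Env d} {U : Set (Site d)} (hω : Set.EqOn ω ω' Uᶜ) (z : Site d)
    {F : Set (Path d)} (hFU : ∀ X ∈ F, ∀ n, X n ∉ U) :
    quenchedLaw ω z F = quenchedLaw ω' z F := by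
  -- `F` need not be measurable. The two laws are compared on the measurable event, containing `F`,
  -- of avoiding `U` forever. It is the decreasing limit of the events `N m`, on which the weights
  -- only read sites outside `U`.
  let N : ℕ → Set (Path d) := fun m => {X | ∀ i ≤ m, X i ∉ U}
  have hN : ∀ m, MeasurableSet (N m) := fun m => by
    have : N m = ⋂ i ∈ Set.Iic m, (fun X : Path d => X i) ⁻¹' Uᶜ := by ext; simp [N]
    rw [this]
    exact MeasurableSet.biInter (Set.to_countable _) fun i _ =>
      (measurable_pi_apply i) MeasurableSet.of_discrete
  have hNm : MeasurableSet (⋂ m, N m) := MeasurableSet.iInter hN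
  have hanti : Antitone N := fun a b hab X hX i hi => hX i (hi.trans hab)
  have key : (quenchedLaw ω z).restrict (⋂ m, N m) = (quenchedLaw ω' z).restrict (⋂ m, N m) := by
    refine path_measure_ext fun n h => ?_
    rw [Measure.restrict_apply (measurableSet_cyl n h),
      Measure.restrict_apply (measurableSet_cyl n h), Set.inter_iInter]
    have hlim : ∀ ω : Env d, Filter.Tendsto (fun m => quenchedLaw ω z (cyl n h ∩ N m))
        Filter.atTop (nhds (quenchedLaw ω z (⋂ m, cyl n h ∩ N m))) := fun ω =>
      tendsto_measure_iInter_atTop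
        (fun m => ((measurableSet_cyl n h).inter (hN m)).nullMeasurableSet)
        (fun a b hab => Set.inter_subset_inter_right _ (hanti hab)) ⟨0, measure_ne_top _ _⟩
    refine tendsto_nhds_unique_of_eventuallyEq (hlim ω) (hlim ω') ?_
    filter_upwards [Filter.eventually_ge_atTop n] with m hm
    have hpre : cyl n h ∩ N m = past m ⁻¹'
        {g | ∀ i : Finset.Iic m, g i ∉ U ∧ (i.1 ≤ n → g i = h i)} := by
      ext X
      simp only [cyl, N, Set.mem_inter_iff, Set.mem_ofPred_eq, Set.mem_preimage, Subtype.forall,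
        Finset.mem_Iic, Preorder.frestrictLe_apply]
      exact ⟨fun H i hi => ⟨H.2 i hi, H.1 i⟩,
        fun H => ⟨fun i hi => (H i (hi.trans hm)).2 hi, fun i hi => (H i hi).1⟩⟩
    rw [hpre]
    refine measure_frestrictLe_preimage_congr m fun g hg => ?_
    rw [quenchedLaw_cyl, quenchedLaw_cyl, weight_congr fun i hi => hω (hg ⟨i, by simp; omega⟩).1]
  have hF : F ⊆ ⋂ m, N m := fun X hX => Set.mem_iInter.2 fun m i _ => hFU X hX i
  rw [← Measure.restrict_eq_self _ hF, key, Measure.restrict_eq_self _ hF]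

theorem stepKernel_translate (ω : Env d) (x y y' : Site d) :
    stepKernel (fun z => ω (z + x)) y {y'} = stepKernel ω (y + x) {y' + x} := by
  change (∑ e : Dir d, ENNReal.ofReal ((ω (y + x)).1 e) • Measure.dirac (y + e.vec)) {y'} =
    (∑ e : Dir d, ENNReal.ofReal ((ω (y + x)).1 e) • Measure.dirac (y + x + e.vec)) {y' + x}
  simp only [Measure.coe_finsetSum, Finset.sum_apply, Measure.smul_apply]
  refine Finset.sum_congr rfl fun e _ => ?_
  rw [Measure.dirac_apply, Measure.dirac_apply]
  congr 1
  have : y + x + e.vec = y' + x ↔ y + e.vec = y' := by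
    rw [add_right_comm, add_left_inj]
  simp [Set.indicator_apply, this]

theorem quenchedLaw_translate (ω : Env d) (x : Site d) :
    (quenchedLaw (fun z => ω (z + x)) 0).map (fun X n => X n + x) = quenchedLaw ω x := by
  have hm : Measurable fun (X : Path d) n => X n + x :=
    measurable_pi_iff.2 fun n => 
      Measurable.add_const (f := fun X : Path d => X n) (measurable_pi_apply n) x
  have := Measure.isProbabilityMeasure_map (μ := quenchedLaw (fun z => ω (z + x)) 0) hm.aemeasurable
  refine path_measure_ext fun n h => ?_
  rw [Measure.map_apply hm (measurableSet_cyl n h)]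
  have : (fun (X : Path d) n => X n + x) ⁻¹' cyl n h = cyl n fun i => h i - x := by
    ext X
    simp [cyl, eq_sub_iff_add_eq]
  rw [this, quenchedLaw_cyl, quenchedLaw_cyl]
  simp [sub_eq_zero, weight, stepKernel_translate]

theorem measurable_shift (n : ℕ) : Measurable fun (X : Path d) i => X (n + i) := by fun_prop

/-- The Markov property of the quenched walk. -/
theorem quenchedLaw_markov (ω : Env d) (z : Site d) (n : ℕ) (h : Path d) {F : Set (Path d)}
    (hF : MeasurableSet F) :
    quenchedLaw ω z (cyl n h ∩ (fun X i => X (n + i)) ⁻¹' F) =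
      quenchedLaw ω z (cyl n h) * quenchedLaw ω (h n) F := by
  have hm := measurable_shift (d := d) n
  suffices H : ((quenchedLaw ω z).restrict (cyl n h)).map (fun X i => X (n + i)) =
      quenchedLaw ω z (cyl n h) • quenchedLaw ω (h n) by
    rw [Set.inter_comm, ← Measure.restrict_apply (hm hF), ← Measure.map_apply hm hF, H]
    rfl
  refine path_measure_ext fun m g => ?_
  rw [Measure.map_apply hm (measurableSet_cyl m g),
    Measure.restrict_apply (hm (measurableSet_cyl m g)), Measure.smul_apply, smul_eq_mul,
    quenchedLaw_cyl ω (h n)]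
  split_ifs with hg
  -- The concatenation of `h` and `g` at time `n`, consistent because `g 0 = h n`.
  · let k : Path d := fun i => if i ≤ n then h i else g (i - n)
    have hk1 : ∀ i ≤ n, k i = h i := fun i hi => by simp [k, hi]
    have hk2 : ∀ i, k (n + i) = g i := fun i => by
      rcases i.eq_zero_or_pos with rfl | hi
      · simp [k, hg]
      · simp [k, hi.ne']
    have : (fun (X : Path d) i => X (n + i)) ⁻¹' cyl m g ∩ cyl n h = cyl (n + m) k := by
      ext X
      simp only [cyl, Set.mem_inter_iff, Set.mem_preimage, Set.mem_ofPred_eq]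
      constructor
      · rintro ⟨h1, h2⟩ i hi
        rcases le_total i n with hin | hin
        · rw [h2 i hin, hk1 i hin]
        · obtain ⟨j, rfl⟩ := Nat.exists_eq_add_of_le hin
          rw [hk2, h1 j (by omega)]
      · intro H
        exact ⟨fun i hi => by rw [H (n + i) (by omega), hk2],
          fun i hi => by rw [H i (by omega), hk1 i hi]⟩
    rw [this, quenchedLaw_cyl, quenchedLaw_cyl, hk1 0 (Nat.zero_le n)]
    have hw : weight ω k (n + m) = weight ω h n * weight ω g m := by
      rw [weight, Finset.prod_range_add]
      congr 1
      · refine Finset.prod_congr rfl fun i hi => ?_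
        have := Finset.mem_range.1 hi
        rw [hk1 i this.le, hk1 (i + 1) this]
      · refine Finset.prod_congr rfl fun i _ => ?_
        rw [hk2, add_assoc, hk2]
    rw [hw]
    split_ifs <;> simp
  · rw [mul_zero]
    convert measure_empty (μ := quenchedLaw ω z)
    refine Set.eq_empty_of_forall_notMem fun X hX => hg ?_
    rw [← hX.1 0 (Nat.zero_le m), ← hX.2 n le_rfl]
    rfl

theorem quenchedLaw_start (ω : Env d) (z : Site d) : ∀ᵐ X ∂quenchedLaw ω z, X 0 = z := by
  have h : quenchedLaw ω z (cyl 0 fun _ => z) = 1 := by simp [quenchedLaw_cyl, weight]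
  have := (prob_compl_eq_zero_iff (measurableSet_cyl 0 fun _ => z)).2 h
  refine measure_mono_null (fun X hX => ?_) this
  intro H
  exact hX (H 0 le_rfl)

end Quenched


/-! ### The annealed walk and its regeneration times -/

section Annealed

variable {d : ℕ} (Q : Measure (StepLaw d)) [IsProbabilityMeasure Q]

instance : IsProbabilityMeasure (envLaw Q) := by unfold envLaw; infer_instance

theorem measurePreserving_envLaw_translate (x : Site d) :
    MeasurePreserving (fun (ω : Env d) z => ω (z + x)) (envLaw Q) (envLaw Q) :=
  measurePreserving_comp_injective Q (add_left_injective x)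

/-- The annealed law of the walk. -/
noncomputable def walkLaw {d : ℕ} (Q : Measure (StepLaw d)) : Measure (Path d) :=
  (jointLaw Q).map Prod.snd

instance : IsProbabilityMeasure (walkLaw Q) :=
  Measure.isProbabilityMeasure_map measurable_snd.aemeasurable

theorem measurable_quenchedLaw_apply (x : Site d) {F : Set (Path d)} (hF : MeasurableSet F) :
    Measurable fun ω : Env d => quenchedLaw ω x F :=
  (Measure.measurable_coe hF).comp (measurable_quenchedLaw x)

theorem walkLaw_apply {F : Set (Path d)} (hF : MeasurableSet F) :
    walkLaw Q F = ∫⁻ ω, quenchedLaw ω 0 F ∂envLaw Q := by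
  rw [walkLaw, Measure.map_apply measurable_snd hF, jointLaw,
    Measure.compProd_apply (measurable_snd hF)]
  rfl

/-- By stationarity of the environment the starting point does not matter for translation-invariant
events. -/
theorem lintegral_quenchedLaw {F : Set (Path d)} (hF : MeasurableSet F) (x : Site d)
    (hFx : (fun (X : Path d) n => X n + x) ⁻¹' F = F) :
    ∫⁻ ω, quenchedLaw ω x F ∂envLaw Q = walkLaw Q F := by
  have hm : Measurable fun (X : Path d) n => X n + x :=
    measurable_pi_iff.2 fun n =>
      Measurable.add_const (f := fun X : Path d => X n) (measurable_pi_apply n) x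
  rw [walkLaw_apply Q hF, ← (measurePreserving_envLaw_translate Q x).lintegral_comp
    (measurable_quenchedLaw_apply 0 hF)]
  refine lintegral_congr fun ω => ?_
  rw [← quenchedLaw_translate ω x, Measure.map_apply hm hF, hFx]

/-! ### Records, regeneration times and their existence -/

theorem level_add (ℓ : Dir d) (x y : Site d) : level ℓ (x + y) = level ℓ x + level ℓ y := by
  simp [level, mul_add]

theorem level_sub (ℓ : Dir d) (x y : Site d) : level ℓ (x - y) = level ℓ x - level ℓ y := by
  simp [level, mul_sub]

/-- The time `n` is a strict record of the trajectory in the direction `ℓ`. -/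
def IsRecord (ℓ : Dir d) (X : Path d) (n : ℕ) : Prop := ∀ s < n, level ℓ (X s) < level ℓ (X n)

theorem measurable_level_apply (ℓ : Dir d) (n : ℕ) :
    Measurable fun X : Path d => level ℓ (X n) :=
  (measurable_level ℓ).comp (measurable_pi_apply n)

theorem measurableSet_isRecord (ℓ : Dir d) (n : ℕ) :
    MeasurableSet {X : Path d | IsRecord ℓ X n} := by
  have : {X : Path d | IsRecord ℓ X n} =
      ⋂ s ∈ Set.Iio n, {X | level ℓ (X s) < level ℓ (X n)} := by
    ext X; simp [IsRecord]
  rw [this]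
  exact MeasurableSet.biInter (Set.to_countable _) fun s _ =>
    measurableSet_lt (measurable_level_apply ℓ s) (measurable_level_apply ℓ n)

theorem measurableSet_isRegeneration (ℓ : Dir d) (n : ℕ) :
    MeasurableSet {X : Path d | IsRegeneration ℓ X n} := by
  have : {X : Path d | IsRegeneration ℓ X n} = {X : Path d | IsRecord ℓ X n} ∩
      ⋂ s ∈ Set.Ioi n, {X | level ℓ (X n) < level ℓ (X s)} := by
    ext X; simp [IsRecord, IsRegeneration]
  rw [this]
  exact (measurableSet_isRecord ℓ n).inter (MeasurableSet.biInter (Set.to_countable _) fun s _ =>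
    measurableSet_lt (measurable_level_apply ℓ n) (measurable_level_apply ℓ s))

theorem preimage_translate_isRegeneration (ℓ : Dir d) (x : Site d) (n : ℕ) :
    (fun (X : Path d) n => X n + x) ⁻¹' {X | IsRegeneration ℓ X n} =
      {X | IsRegeneration ℓ X n} := by
  ext X
  simp [IsRegeneration, level_add]

theorem isRegeneration_zero_shift_iff {ℓ : Dir d} {X : Path d} {n : ℕ} :
    IsRegeneration ℓ (fun i => X (n + i)) 0 ↔ ∀ s > n, level ℓ (X n) < level ℓ (X s) := by
  simp only [IsRegeneration, not_lt_zero, IsEmpty.forall_iff, implies_true, add_zero, true_and]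
  refine ⟨fun H s hs => ?_, fun H s hs => H _ (by omega)⟩
  obtain ⟨k, rfl⟩ := Nat.exists_eq_add_of_le hs.le
  exact H k (by omega)

/-- Before a record at time `n` the walk reads the environment strictly below the level of `h n`. A
walk from `h n` that regenerates at once reads it only at or above that level. The two half-spaces
are independent. -/
theorem walkLaw_cyl_inter_isRegeneration (ℓ : Dir d) {n : ℕ} {h : Path d} (hh : IsRecord ℓ h n) :
    walkLaw Q (cyl n h ∩ {X | IsRegeneration ℓ X n}) =
      walkLaw Q {X | IsRegeneration ℓ X 0} * walkLaw Q (cyl n h) := by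
  have hD := measurableSet_isRegeneration (d := d) ℓ 0
  have hset : cyl n h ∩ {X | IsRegeneration ℓ X n} =
      cyl n h ∩ (fun X i => X (n + i)) ⁻¹' {X | IsRegeneration ℓ X 0} := by
    ext X
    simp only [Set.mem_inter_iff, Set.mem_ofPred_eq, Set.mem_preimage,
      isRegeneration_zero_shift_iff]
    refine and_congr_right fun hX => ⟨fun H => H.2, fun H => ⟨fun s hs => ?_, H⟩⟩
    rw [hX s hs.le, hX n le_rfl]
    exact hh s hs
  rw [hset, walkLaw_apply Q ((measurableSet_cyl n h).inter (measurable_shift n hD))]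
  simp_rw [quenchedLaw_markov _ _ n h hD]
  have := lintegral_mul_of_eqOn Q {z : Site d | level ℓ (h n) ≤ level ℓ z}
    (f := fun ω => quenchedLaw ω 0 (cyl n h))
    (g := fun ω => quenchedLaw ω (h n) {X | IsRegeneration ℓ X 0})
    (measurable_quenchedLaw_apply 0 (measurableSet_cyl n h)) (measurable_quenchedLaw_apply _ hD)
    (fun ω ω' H => ?_) fun ω ω' H => ?_
  · rw [mul_comm, ← lintegral_quenchedLaw Q hD (h n) (preimage_translate_isRegeneration ℓ (h n) 0),
      walkLaw_apply Q (measurableSet_cyl n h)]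
    exact this
  · simp only [quenchedLaw_cyl]
    rw [weight_congr fun i hi => H (x := h i) ?_]
    simpa using hh i hi
  -- Avoidance of the lower half-space must hold for every trajectory in the event, so the almost
  -- sure starting point is made part of it.
  · have hstart : ∀ ω : Env d, quenchedLaw ω (h n) {X | IsRegeneration ℓ X 0} =
        quenchedLaw ω (h n) ({X | IsRegeneration ℓ X 0} ∩ {X | X 0 = h n}) := fun ω =>
      measure_congr <| by
        filter_upwards [quenchedLaw_start ω (h n)] with X hX
        exact propext ⟨fun hr => ⟨hr, hX⟩, fun hr => hr.1⟩
    simp only [hstart]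
    refine quenchedLaw_congr (U := {z | level ℓ (h n) ≤ level ℓ z}ᶜ) (by rwa [compl_compl]) _
      fun X hX k => ?_
    simp only [Set.mem_compl_iff, Set.mem_ofPred_eq, not_not]
    rw [← hX.2]
    rcases k.eq_zero_or_pos with rfl | hk
    · exact le_rfl
    · exact (hX.1.2 k hk).le

theorem measure_eq_zero_of_cyl {μ : Measure (Path d)} (n : ℕ) {A : Set (Path d)}
    (H : ∀ h, μ (cyl n h ∩ A) = 0) : μ A = 0 := by
  have : A ⊆ ⋃ g, cyl n (Function.surjInv (frestrictLe_surjective n) g) ∩ A := fun X hX => by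
    refine Set.mem_iUnion.2 ⟨past n X, ?_, hX⟩
    rw [cyl_eq_preimage]
    exact (Function.surjInv_eq (frestrictLe_surjective n) (past n X)).symm
  exact measure_mono_null this (measure_iUnion_null fun g => H _)

theorem exists_last_visit_below {a : ℕ → ℤ} (h : Filter.Tendsto a Filter.atTop Filter.atTop)
    (N : ℤ) (hN : ∃ n, a n ≤ N) : ∃ n, a n ≤ N ∧ ∀ s > n, N < a s := by
  obtain ⟨M, hM⟩ := (h.eventually_gt_atTop N).exists_forall_of_atTop
  classical
  obtain ⟨n, hn⟩ := hN
  refine ⟨Nat.findGreatest (fun n => a n ≤ N) M, ?_, fun s hs => ?_⟩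
  · refine Nat.findGreatest_spec (P := fun n => a n ≤ N) (m := n) ?_ hn
    by_contra hc
    exact absurd (hM n (by omega)) (not_lt.2 hn)
  · by_contra hc
    rcases le_or_gt s M with hsM | hsM
    · exact Nat.findGreatest_is_greatest hs hsM (not_lt.1 hc)
    · exact hc (hM s hsM.le)

/-- A transient trajectory has a last time at or below its initial level, and seen from that time it
regenerates at `0`. If this had probability zero from the origin, then by the Markov property and
stationarity it would be null from every time, and transience would be null. -/
theorem walkLaw_isRegeneration_zero_pos (ℓ : Dir d) (hℓ : 0 < jointLaw Q (transient ℓ)) :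
    0 < walkLaw Q {X | IsRegeneration ℓ X 0} := by
  by_contra hc
  have h0 : walkLaw Q {X | IsRegeneration ℓ X 0} = 0 := by simpa using hc
  have hD := measurableSet_isRegeneration (d := d) ℓ 0
  have h1 : ∀ n, walkLaw Q ((fun X i => X (n + i)) ⁻¹' {X | IsRegeneration ℓ X 0}) = 0 := by
    refine fun n => measure_eq_zero_of_cyl n fun h => ?_
    rw [walkLaw_apply Q ((measurableSet_cyl n h).inter (measurable_shift n hD)), ← nonpos_iff_eq_zero]
    calc _ ≤ ∫⁻ ω, quenchedLaw ω (h n) {X | IsRegeneration ℓ X 0} ∂envLaw Q := by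
          refine lintegral_mono fun ω => ?_
          rw [quenchedLaw_markov _ _ n h hD]
          exact mul_le_of_le_one_left' prob_le_one
      _ = 0 := by
          rw [lintegral_quenchedLaw Q hD (h n) (preimage_translate_isRegeneration ℓ (h n) 0), h0]
  have h2 : walkLaw Q {X | Filter.Tendsto (fun n => level ℓ (X n)) Filter.atTop Filter.atTop} =
      0 := by
    refine measure_mono_null (fun X hX => ?_) (measure_iUnion_null h1)
    obtain ⟨n, hn, hs⟩ := exists_last_visit_below hX (level ℓ (X 0)) ⟨0, le_rfl⟩
    exact Set.mem_iUnion.2 ⟨n, isRegeneration_zero_shift_iff.2 fun s hsn => hn.trans_lt (hs s hsn)⟩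
  exact hℓ.ne' (Measure.preimage_null_of_map_null measurable_snd.aemeasurable h2)

theorem walkLaw_inter_isRegeneration (ℓ : Dir d) (n : ℕ) (B : Set (Finset.Iic n → Site d)) :
    walkLaw Q (past n ⁻¹' B ∩ {X | IsRegeneration ℓ X n}) =
      walkLaw Q {X | IsRegeneration ℓ X 0} * walkLaw Q (past n ⁻¹' B ∩ {X | IsRecord ℓ X n}) := by
  have hB : MeasurableSet (past n ⁻¹' B) := by
    exact (Preorder.measurable_frestrictLe (X := fun _ : ℕ => Site d) n) MeasurableSet.of_discrete
  rw [← Measure.restrict_apply hB, ← Measure.restrict_apply hB, ← smul_eq_mul,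
    ← Measure.smul_apply]
  refine measure_frestrictLe_preimage_congr n fun h _ => ?_
  rw [Measure.restrict_apply (measurableSet_cyl n h), Measure.smul_apply,
    Measure.restrict_apply (measurableSet_cyl n h), smul_eq_mul]
  by_cases hh : IsRecord ℓ h n
  · rw [walkLaw_cyl_inter_isRegeneration Q ℓ hh]
    congr 2
    refine (Set.inter_eq_left.2 fun X hX s hs => ?_).symm
    rw [hX s hs.le, hX n le_rfl]
    exact hh s hs
  · have h0 : cyl n h ∩ {X | IsRecord ℓ X n} = ∅ := by
      refine Set.eq_empty_of_forall_notMem fun X hX => hh fun s hs => ?_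
      rw [← hX.1 s hs.le, ← hX.1 n le_rfl]
      exact hX.2 s hs
    have h1 : cyl n h ∩ {X | IsRegeneration ℓ X n} = ∅ :=
      Set.subset_eq_empty (Set.inter_subset_inter_right _ fun X hX => hX.1) h0
    rw [h0, h1, measure_empty, mul_zero]

/-- The first time above the maximal level reached up to time `m` is a record. -/
theorem frequently_isRecord {ℓ : Dir d} {X : Path d}
    (hX : Filter.Tendsto (fun n => level ℓ (X n)) Filter.atTop Filter.atTop) (m : ℕ) :
    ∃ n ≥ m, IsRecord ℓ X n := by
  classical
  obtain ⟨N, hN⟩ : ∃ N, ∀ s ≤ m, level ℓ (X s) ≤ N :=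
    ⟨(Finset.Iic m).sup' ⟨m, by simp⟩ fun s => level ℓ (X s), fun s hs =>
      Finset.le_sup' (fun s => level ℓ (X s)) (Finset.mem_Iic.2 hs)⟩
  have hex : ∃ n, N < level ℓ (X n) := (hX.eventually_gt_atTop N).exists
  refine ⟨Nat.find hex, ?_, fun s hs => ?_⟩
  · by_contra hc
    exact absurd (Nat.find_spec hex) (not_lt.2 (hN _ (by omega)))
  · exact (not_lt.1 (Nat.find_min hex hs)).trans_lt (Nat.find_spec hex)

theorem iSup_piLE_path :
    ⨆ n, (Filtration.piLE (X := fun _ : ℕ => Site d)) n = MeasurableSpace.pi := by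
  refine le_antisymm (iSup_le fun n => Filtration.piLE.le n) ?_
  refine iSup_le fun n => le_trans ?_ (le_iSup _ n)
  rw [Filtration.piLE_eq_comap_frestrictLe]
  rintro _ ⟨s, hs, rfl⟩
  exact ⟨(fun g : Finset.Iic n → Site d => g ⟨n, by simp⟩) ⁻¹' s,
    (measurable_pi_apply (X := fun _ : Finset.Iic n => Site d) _) hs, rfl⟩

/-- `walkLaw_inter_isRegeneration` is exactly the defining identity of this conditional expectation,
tested on events of the past. -/
theorem condExp_isRegeneration (ℓ : Dir d) (n : ℕ) :
    {X | IsRecord ℓ X n}.indicator (fun _ => (walkLaw Q {X | IsRegeneration ℓ X 0}).toReal)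
      =ᵐ[walkLaw Q] (walkLaw Q)[{X | IsRegeneration ℓ X n}.indicator (fun _ => (1 : ℝ)) |
        Filtration.piLE (X := fun _ : ℕ => Site d) n] := by
  have hR := measurableSet_isRegeneration (d := d) ℓ n
  have hr := measurableSet_isRecord (d := d) ℓ n
  refine ae_eq_condExp_of_forall_setIntegral_eq (Filtration.piLE.le n)
    ((integrable_const _).indicator hR)
    (fun s _ _ => ((integrable_const _).indicator hr).integrableOn) (fun s hs _ => ?_) ?_
  · have hs' := Filtration.piLE.le n s hs
    rw [Filtration.piLE_eq_comap_frestrictLe] at hs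
    obtain ⟨B, -, rfl⟩ := hs
    rw [setIntegral_indicator hr, setIntegral_indicator hR, setIntegral_const, setIntegral_const,
      smul_eq_mul, smul_eq_mul, mul_one, Measure.real, Measure.real,
      walkLaw_inter_isRegeneration Q ℓ n B, ENNReal.toReal_mul, mul_comm]
  · refine StronglyMeasurable.aestronglyMeasurable
      (StronglyMeasurable.indicator stronglyMeasurable_const ?_)
    rw [Filtration.piLE_eq_comap_frestrictLe]
    refine ⟨{g | ∀ s : Finset.Iic n, s.1 < n → level ℓ (g s) < level ℓ (g ⟨n, by simp⟩)},
      MeasurableSet.of_discrete, ?_⟩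
    ext X
    simp only [Set.mem_preimage, Set.mem_ofPred_eq, Subtype.forall, Finset.mem_Iic,
      Preorder.frestrictLe_apply, IsRecord]
    exact ⟨fun H s hs => H s hs.le hs, fun H s _ hs => H s hs⟩

/-- Almost surely, a walk that is transient in the direction `ℓ` regenerates infinitely often. -/
theorem ae_exists_isRegeneration (ℓ : Dir d) (hℓ : 0 < jointLaw Q (transient ℓ)) :
    ∀ᵐ X ∂walkLaw Q, Filter.Tendsto (fun n => level ℓ (X n)) Filter.atTop Filter.atTop →
      ∀ m, ∃ n ≥ m, IsRegeneration ℓ X n := by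
  have hq : 0 < (walkLaw Q {X | IsRegeneration ℓ X 0}).toReal :=
    ENNReal.toReal_pos (walkLaw_isRegeneration_zero_pos Q ℓ hℓ).ne' (measure_ne_top _ _)
  suffices H : ∀ m, ∀ᵐ X ∂walkLaw Q,
      Filter.Tendsto (fun n => level ℓ (X n)) Filter.atTop Filter.atTop →
        ∃ n ≥ m, IsRegeneration ℓ X n by
    filter_upwards [ae_all_iff.2 H] with X hX hT m using hX m hT
  intro m
  let B : Set (Path d) := {X | ∃ n ≥ m, IsRegeneration ℓ X n}
  have hB : MeasurableSet B := by
    have : B = ⋃ n ∈ Set.Ici m, {X | IsRegeneration ℓ X n} := by ext; simp [B]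
    rw [this]
    exact MeasurableSet.biUnion (Set.to_countable _) fun n _ => measurableSet_isRegeneration ℓ n
  have hBi : Integrable (B.indicator fun _ => (1 : ℝ)) (walkLaw Q) :=
    (integrable_const _).indicator hB
  -- Lévy's upward theorem: off `B` the conditional probability of `B` tends to `0`. By `hle` it is
  -- at least the constant `q > 0` at every record from time `m` on, and such records occur
  -- arbitrarily late.
  have hlim := hBi.tendsto_ae_condExp (ℱ := Filtration.piLE (X := fun _ : ℕ => Site d)) (by
    rw [iSup_piLE_path]
    exact stronglyMeasurable_const.indicator hB)
  have hle : ∀ n, m ≤ n → {X | IsRecord ℓ X n}.indicator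
      (fun _ => (walkLaw Q {X | IsRegeneration ℓ X 0}).toReal) ≤ᵐ[walkLaw Q]
        (walkLaw Q)[B.indicator (fun _ => (1 : ℝ)) |
          Filtration.piLE (X := fun _ : ℕ => Site d) n] := fun n hn =>
    (condExp_isRegeneration Q ℓ n).le.trans (condExp_mono
      ((integrable_const _).indicator (measurableSet_isRegeneration ℓ n)) hBi
      (ae_of_all _ fun X => Set.indicator_le_indicator_of_subset
        (s := {X | IsRegeneration ℓ X n}) (t := B) (fun X hX => ⟨n, hn, hX⟩)
        (fun _ => zero_le_one) X))
  filter_upwards [hlim, ae_all_iff.2 fun n => ae_all_iff.2 (hle n)] with X hX hXle hT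
  by_contra hc
  have hXB : X ∉ B := hc
  rw [Set.indicator_of_notMem hXB] at hX
  obtain ⟨N, hN⟩ := (hX.eventually_lt_const hq).exists_forall_of_atTop
  obtain ⟨n, hn, hrec⟩ := frequently_isRecord hT (max m N)
  have h1 := hXle n ((le_max_left _ _).trans hn)
  rw [Set.indicator_of_mem (show X ∈ {X | IsRecord ℓ X n} from hrec)] at h1
  exact absurd (hN n ((le_max_right _ _).trans hn)) (not_lt.2 h1)

end Annealed


/-! ### Resampling a regeneration slab along the path -/

section Resampling

variable {d : ℕ} (Q : Measure (StepLaw d)) [IsProbabilityMeasure Q]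

/-- The slab with its environment forgotten. -/
noncomputable def strip (ℓ : Dir d) (S : Slab d) : Slab d := (S.1, fun _ => placeholder ℓ, S.2.2)

/-- The sites of the slab that are not on its path. -/
def offPath (ℓ : Dir d) (S : Slab d) : Set (Site d) :=
  {z | z ∈ slabSet ℓ S.L ∧ ∀ t ≤ S.u, S.K t ≠ z}

open Classical in
/-- The environment of the slab, replaced by `V` on the path and outside of the slab. -/
noncomputable def resample (ℓ : Dir d) (p : Slab d × Env d) : Env d :=
  (offPath ℓ p.1).piecewise p.1.W p.2

theorem measurable_strip (ℓ : Dir d) : Measurable (strip (d := d) ℓ) :=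
  measurable_fst.prodMk (measurable_const.prodMk (measurable_snd.comp measurable_snd))

theorem measurable_slab_L : Measurable fun S : Slab d => S.L := measurable_fst

theorem measurable_slab_W (z : Site d) : Measurable fun S : Slab d => S.W z :=
  (measurable_pi_apply z).comp (measurable_fst.comp measurable_snd)

theorem measurable_slab_u : Measurable fun S : Slab d => S.u :=
  measurable_fst.comp (measurable_snd.comp measurable_snd)

theorem measurable_slab_K (t : ℕ) : Measurable fun S : Slab d => S.K t :=
  (measurable_pi_apply t).comp (measurable_snd.comp (measurable_snd.comp measurable_snd))

theorem measurableSet_mem_offPath (ℓ : Dir d) (z : Site d) :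
    MeasurableSet {S : Slab d | z ∈ offPath ℓ S} := by
  have : {S : Slab d | z ∈ offPath ℓ S} = {S | z ∈ slabSet ℓ S.L} ∩
      ⋂ t, ({S | t ≤ S.u}ᶜ ∪ {S | S.K t = z}ᶜ) := by
    ext S
    simp [offPath, imp_iff_not_or]
  rw [this]
  refine MeasurableSet.inter
    (measurable_slab_L (t := {L : ℤ | z ∈ slabSet ℓ L}) MeasurableSet.of_discrete)
    (MeasurableSet.iInter fun t => MeasurableSet.union ?_ ?_)
  · exact (measurableSet_le measurable_const measurable_slab_u).compl
  · exact (measurable_slab_K t (measurableSet_singleton z)).compl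

theorem measurable_resample (ℓ : Dir d) : Measurable (resample (d := d) ℓ) := by
  classical
  refine measurable_pi_iff.2 fun z => ?_
  exact Measurable.ite (measurable_fst (measurableSet_mem_offPath ℓ z))
    ((measurable_slab_W z).comp measurable_fst) ((measurable_pi_apply z).comp measurable_snd)

/-- Integrating out the walk leaves two independent i.i.d. environments, on which the coordinate
exchange can act. -/
theorem jointLaw_prod_apply {S : Set (Env d × Env d)} (hS : MeasurableSet S) {E : Set (Path d)}
    (hE : MeasurableSet E) :
    ((jointLaw Q).prod (envLaw Q)) {q | q.1.2 ∈ E ∧ (q.1.1, q.2) ∈ S} =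
      ∫⁻ q, S.indicator 1 q * quenchedLaw q.1 0 E ∂(envLaw Q).prod (envLaw Q) := by
  have hSm : MeasurableSet {q : (Env d × Path d) × Env d | q.1.2 ∈ E ∧ (q.1.1, q.2) ∈ S} :=
    ((measurable_snd.comp measurable_fst) hE).inter
      (((measurable_fst.comp measurable_fst).prodMk measurable_snd) hS)
  have hf : Measurable fun q : Env d × Env d => S.indicator 1 q * quenchedLaw q.1 0 E :=
    (measurable_one.indicator hS).mul
      ((measurable_quenchedLaw_apply 0 hE).comp measurable_fst)
  rw [Measure.prod_apply hSm, jointLaw,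
    Measure.lintegral_compProd (measurable_measure_prodMk_left hSm), lintegral_prod _ hf.aemeasurable]
  refine lintegral_congr fun ω => ?_
  have h1 : ∀ X : Path d,
      envLaw Q (Prod.mk (ω, X) ⁻¹' {q | q.1.2 ∈ E ∧ (q.1.1, q.2) ∈ S}) =
        E.indicator (fun _ => envLaw Q (Prod.mk ω ⁻¹' S)) X := by
    intro X
    by_cases hX : X ∈ E
    · rw [Set.indicator_of_mem hX]
      congr 1
      ext V
      simp [hX]
    · rw [Set.indicator_of_notMem hX]
      simp [hX]
  simp_rw [h1]
  have hSω : MeasurableSet (Prod.mk ω ⁻¹' S) := measurable_prodMk_left hS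
  change _ = ∫⁻ V, (Prod.mk ω ⁻¹' S).indicator 1 V * quenchedLaw ω 0 E ∂envLaw Q
  rw [lintegral_indicator_const hE, lintegral_mul_const _ (measurable_one.indicator hSω),
    lintegral_indicator_one hSω]
  rfl

open Classical in
/-- The environment in a set `U` which the walk avoids is independent of the walk. -/
theorem jointLaw_prod_piecewise (x : Site d) (U : Set (Site d)) {E : Set (Path d)}
    (hE : MeasurableSet E) (hEU : ∀ X ∈ E, ∀ n, X n - x ∉ U) {B : Set (Env d)}
    (hB : MeasurableSet B) :
    ((jointLaw Q).prod (envLaw Q))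
        {q | q.1.2 ∈ E ∧ U.piecewise (fun z => q.1.1 (z + x)) q.2 ∈ B} =
      ((jointLaw Q).prod (envLaw Q)) {q | q.1.2 ∈ E ∧ q.2 ∈ B} := by
  set P := envLaw Q with hP
  have hθ : MeasurePreserving (fun (q : Env d × Env d) => ((fun z => q.1 (z + x)), q.2))
      (P.prod P) (P.prod P) :=
    (measurePreserving_envLaw_translate Q x).prod (MeasurePreserving.id P)
  have hpw := measurable_piecewise_pair (E := StepLaw d) U
  -- The quenched probability of `E` as a function of the environment seen from `x`; in these
  -- coordinates it ignores `U`.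
  let f : Env d → ENNReal := fun ω => quenchedLaw (fun z => ω (z - x)) 0 E
  have hf : Measurable f := (measurable_quenchedLaw_apply 0 hE).comp (by fun_prop)
  have hfθ : ∀ ω : Env d, f (fun z => ω (z + x)) = quenchedLaw ω 0 E := fun ω => by simp [f]
  have hfU : ∀ ω ω', Set.EqOn ω ω' Uᶜ → f ω = f ω' := fun ω ω' H =>
    quenchedLaw_congr (U := {z | z - x ∈ U}) (fun z hz => H hz) 0 hEU
  have hB1 : MeasurableSet {q : Env d × Env d | U.piecewise (fun z => q.1 (z + x)) q.2 ∈ B} :=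
    (hpw.comp hθ.measurable) hB
  have hB2 : MeasurableSet {q : Env d × Env d | q.2 ∈ B} := measurable_snd hB
  have hi : Measurable (B.indicator (1 : Env d → ENNReal)) := measurable_one.indicator hB
  have hH : Measurable fun q : Env d × Env d => B.indicator 1 q.1 * f q.2 :=
    (hi.comp measurable_fst).mul (hf.comp measurable_snd)
  have hG : Measurable fun q : Env d × Env d => B.indicator 1 (U.piecewise q.1 q.2) * f q.1 :=
    (hi.comp hpw).mul (hf.comp measurable_fst)
  have hG' : Measurable fun q : Env d × Env d => B.indicator 1 q.2 * f q.1 :=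
    (hi.comp measurable_snd).mul (hf.comp measurable_fst)
  calc _ = ∫⁻ q, B.indicator 1 (U.piecewise (fun z => q.1 (z + x)) q.2) *
          f (fun z => q.1 (z + x)) ∂P.prod P := by
        refine (jointLaw_prod_apply Q hB1 hE).trans (lintegral_congr fun q => ?_)
        rw [hfθ]
        rfl
    _ = ∫⁻ q, B.indicator 1 (U.piecewise q.1 q.2) * f q.1 ∂P.prod P := hθ.lintegral_comp hG
    _ = ∫⁻ q, B.indicator 1 (U.piecewise q.1 q.2) * f (U.piecewise q.2 q.1) ∂P.prod P := by
        refine lintegral_congr fun q => ?_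
        rw [hfU q.1 (U.piecewise q.2 q.1) fun i hi => by
          simp [Set.piecewise_eq_of_notMem _ _ _ hi]]
    _ = ∫⁻ q, B.indicator 1 q.1 * f q.2 ∂P.prod P :=
        (measurePreserving_piecewise Q U).lintegral_comp hH
    _ = ∫⁻ q, B.indicator 1 q.2 * f q.1 ∂P.prod P :=
        (Measure.measurePreserving_swap (μ := P) (ν := P)).lintegral_comp hG'
    _ = ∫⁻ q, B.indicator 1 q.2 * f (fun z => q.1 (z + x)) ∂P.prod P :=
        (hθ.lintegral_comp hG').symm
    _ = _ := by
        refine Eq.trans (lintegral_congr fun q => ?_) (jointLaw_prod_apply Q hB2 hE).symm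
        rw [hfθ]
        rfl

/-! ### Decomposition by the path up to the second regeneration time -/

theorem measure_eq_of_forall_fiber {α I : Type*} [MeasurableSpace α] [Countable I]
    {μ : Measure α} {c : α → I} (hc : ∀ i, MeasurableSet (c ⁻¹' {i})) {s t : Set α}
    (H : ∀ i, μ (c ⁻¹' {i} ∩ s) = μ (c ⁻¹' {i} ∩ t)) : μ s = μ t := by
  have key : ∀ s, μ s = ∑' i, μ (c ⁻¹' {i} ∩ s) := fun s => by
    simp_rw [← Measure.restrict_apply (hc _)]
    rw [← measure_iUnion (fun i j hij => ?_) hc, ← Set.preimage_iUnion]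
    · rw [Set.iUnion_of_singleton, Set.preimage_univ, Measure.restrict_apply_univ]
    · exact Disjoint.preimage _ (Set.disjoint_singleton.2 hij)
  rw [key s, key t]
  simp_rw [H]

/-- The first two regeneration times exist. -/
def HasSlab (ℓ : Dir d) (X : Path d) : Prop :=
  IsRegeneration ℓ X (regTime ℓ X 0) ∧ IsRegeneration ℓ X (regTime ℓ X 1) ∧
    regTime ℓ X 0 < regTime ℓ X 1

theorem measurableSet_hasSlab (ℓ : Dir d) : MeasurableSet {X : Path d | HasSlab ℓ X} := by
  have h : ∀ k, MeasurableSet {X : Path d | IsRegeneration ℓ X (regTime ℓ X k)} := fun k => by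
    have : {X : Path d | IsRegeneration ℓ X (regTime ℓ X k)} =
        ⋃ n, ({X | regTime ℓ X k = n} ∩ {X | IsRegeneration ℓ X n}) := by
      ext X; simp
    rw [this]
    exact MeasurableSet.iUnion fun n => ((measurable_regTime ℓ k) (measurableSet_singleton n)).inter
      (measurableSet_isRegeneration ℓ n)
  exact (h 0).inter ((h 1).inter
    (measurableSet_lt (measurable_regTime ℓ 0) (measurable_regTime ℓ 1)))

theorem measurableSet_tendsto_level (ℓ : Dir d) : MeasurableSet
    {X : Path d | Filter.Tendsto (fun n => level ℓ (X n)) Filter.atTop Filter.atTop} := by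
  have : {X : Path d | Filter.Tendsto (fun n => level ℓ (X n)) Filter.atTop Filter.atTop} =
      ⋂ N : ℤ, ⋃ m : ℕ, ⋂ n ∈ Set.Ici m, {X | N ≤ level ℓ (X n)} := by
    ext X; simp [Filter.tendsto_atTop]
  rw [this]
  exact MeasurableSet.iInter fun N => MeasurableSet.iUnion fun m =>
    MeasurableSet.biInter (Set.to_countable _) fun n _ =>
      measurableSet_le measurable_const (measurable_level_apply ℓ n)

theorem measurableSet_transient (ℓ : Dir d) : MeasurableSet (transient (d := d) ℓ) :=
  measurable_snd (measurableSet_tendsto_level ℓ)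

theorem ae_hasSlab (ℓ : Dir d) (hℓ : 0 < jointLaw Q (transient ℓ)) :
    ∀ᵐ p ∂(jointLaw Q)[|transient ℓ], HasSlab ℓ p.2 := by
  have h := ae_of_ae_map measurable_snd.aemeasurable (ae_exists_isRegeneration Q ℓ hℓ)
  filter_upwards [cond_absolutelyContinuous.ae_le h, ae_cond_mem (measurableSet_transient ℓ)]
    with p hp hT
  -- Infinitely many regeneration times exclude the default value `0` of `Nat.nth`.
  have hinf : {n | IsRegeneration ℓ p.2 n}.Infinite := by
    rw [Set.infinite_iff_frequently_cofinite, Nat.cofinite_eq_atTop, Filter.frequently_atTop]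
    exact hp hT
  exact ⟨Nat.nth_mem_of_infinite hinf 0, Nat.nth_mem_of_infinite hinf 1,
    Nat.nth_strictMono hinf zero_lt_one⟩

/-- The first two regeneration times, together with the path until the second one. -/
noncomputable def slabHistory (ℓ : Dir d) (X : Path d) : ℕ × (m : ℕ) × (Finset.Iic m → Site d) :=
  (regTime ℓ X 0, ⟨regTime ℓ X 1, past _ X⟩)

theorem slabHistory_eq_iff {ℓ : Dir d} {X h : Path d} {n m : ℕ} :
    slabHistory ℓ X = (n, ⟨m, past m h⟩) ↔
      regTime ℓ X 0 = n ∧ regTime ℓ X 1 = m ∧ X ∈ cyl m h := by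
  rw [cyl_eq_preimage, slabHistory, Prod.mk.injEq]
  refine and_congr_right fun _ => ⟨fun H => ?_, ?_⟩
  · obtain ⟨h1, h2⟩ := Sigma.mk.inj H
    subst h1
    exact ⟨rfl, eq_of_heq h2⟩
  · rintro ⟨rfl, H⟩
    exact congrArg (Sigma.mk _) H

theorem measurableSet_slabHistory (ℓ : Dir d) (i : ℕ × (m : ℕ) × (Finset.Iic m → Site d)) :
    MeasurableSet {X : Path d | slabHistory ℓ X = i} := by
  obtain ⟨n, m, g⟩ := i
  obtain ⟨h, rfl⟩ := frestrictLe_surjective m g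
  simp only [slabHistory_eq_iff]
  exact ((measurable_regTime ℓ 0) (measurableSet_singleton n)).inter
    (((measurable_regTime ℓ 1) (measurableSet_singleton m)).inter (measurableSet_cyl m h))

/-- The slab of the trajectory `h` between the times `n` and `m`, without environment. -/
noncomputable def pathSlab (ℓ : Dir d) (h : Path d) (n m : ℕ) : Slab d :=
  (level ℓ (h m) - level ℓ (h n), fun _ => placeholder ℓ, m - n,
    fun s => h (n + min s (m - n)) - h n)

theorem strip_slab {ℓ : Dir d} {p : Env d × Path d} {h : Path d} {n m : ℕ} (hnm : n ≤ m)
    (hn : regTime ℓ p.2 0 = n) (hm : regTime ℓ p.2 1 = m) (hp : p.2 ∈ cyl m h) :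
    strip ℓ (slab ℓ 0 p) = pathSlab ℓ h n m := by
  have h1 : p.2 m = h m := hp m le_rfl
  have h2 : p.2 n = h n := hp n hnm
  simp only [strip, slab, pathSlab, zero_add, hn, hm, h1, h2]
  refine Prod.ext rfl (Prod.ext rfl (Prod.ext rfl (funext fun s => ?_)))
  simp only
  rw [hp _ (by omega)]

open Classical in
theorem resample_slab {ℓ : Dir d} {p : Env d × Path d} (V : Env d) {h : Path d} {n m : ℕ}
    (hnm : n ≤ m)
    (hn : regTime ℓ p.2 0 = n) (hm : regTime ℓ p.2 1 = m) (hp : p.2 ∈ cyl m h) :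
    resample ℓ (slab ℓ 0 p, V) =
      (offPath ℓ (pathSlab ℓ h n m)).piecewise (fun z => p.1 (z + h n)) V := by
  have hs := strip_slab hnm hn hm hp
  have ho : offPath ℓ (slab ℓ 0 p) = offPath ℓ (pathSlab ℓ h n m) := by rw [← hs]; rfl
  rw [resample]
  funext z
  by_cases hz : z ∈ offPath ℓ (pathSlab ℓ h n m)
  · rw [Set.piecewise_eq_of_mem _ _ _ hz, Set.piecewise_eq_of_mem _ _ _ (ho ▸ hz)]
    rw [← ho] at hz
    have h2 : p.2 n = h n := hp n hnm
    have := hz.1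
    simp only [slab, Slab.L, Slab.W, hn, h2] at this ⊢
    rw [if_pos this]
  · rw [Set.piecewise_eq_of_notMem _ _ _ hz, Set.piecewise_eq_of_notMem _ _ _ (ho ▸ hz)]

/-- Before time `n` the walk is strictly below the slab, from `n` to `m` it is on the recorded path,
and after `m` it is above the slab. -/
theorem avoid_offPath {ℓ : Dir d} {X h : Path d} {n m : ℕ} (hnm : n < m)
    (hn : IsRegeneration ℓ X n) (hm : IsRegeneration ℓ X m) (hX : X ∈ cyl m h) (k : ℕ) :
    X k - h n ∉ offPath ℓ (pathSlab ℓ h n m) := by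
  have h1 : X m = h m := hX m le_rfl
  have h2 : X n = h n := hX n hnm.le
  rintro ⟨⟨hlow, hhigh⟩, hpath⟩
  rw [level_sub] at hlow hhigh
  simp only [pathSlab, Slab.L, Slab.u, Slab.K] at hhigh hpath
  rcases lt_or_ge k n with hk | hk
  · have := hn.1 k hk
    rw [h2] at this
    omega
  rcases le_or_gt k m with hkm | hkm
  · refine hpath (k - n) (by omega) ?_
    rw [min_eq_left (by omega), Nat.add_sub_cancel' hk, hX k hkm]
  · have := hm.2 k hkm
    rw [h1] at this
    omega

/-- If the environment of a slab is resampled on the path (and extended to all sites), then it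
becomes an i.i.d. environment that is independent of the rest of the slab. -/
theorem measurePreserving_resample (ℓ : Dir d) (hℓ : 0 < jointLaw Q (transient ℓ)) :
    MeasurePreserving (fun p : Slab d × Env d => (strip ℓ p.1, resample ℓ p))
      ((slabLaw Q ℓ).prod (envLaw Q)) (((slabLaw Q ℓ).map (strip ℓ)).prod (envLaw Q)) := by
  have hlaw := isProbabilityMeasure_slabLaw Q ℓ hℓ
  have hcond : IsProbabilityMeasure ((jointLaw Q)[|transient ℓ]) :=
    cond_isProbabilityMeasure hℓ.ne'
  have hfinite : IsFiniteMeasure ((jointLaw Q)[|transient ℓ]) := inferInstance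
  have hsigma : SigmaFinite ((jointLaw Q)[|transient ℓ]) := inferInstance
  have hφ : Measurable fun p : Slab d × Env d => (strip ℓ p.1, resample ℓ p) :=
    ((measurable_strip ℓ).comp measurable_fst).prodMk (measurable_resample ℓ)
  have hs := measurable_slab (d := d) ℓ 0
  have hstrip := Measure.isProbabilityMeasure_map (μ := slabLaw Q ℓ)
    (measurable_strip ℓ).aemeasurable
  have hsV : Measurable fun q : (Env d × Path d) × Env d => (slab ℓ 0 q.1, q.2) :=
    (hs.comp measurable_fst).prodMk measurable_snd
  refine ⟨hφ, (Measure.prod_eq fun A B hA hB => ?_).symm⟩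
  have hprod : (slabLaw Q ℓ).prod (envLaw Q) =
      (((jointLaw Q)[|transient ℓ]).prod (envLaw Q)).map fun q => (slab ℓ 0 q.1, q.2) := by
    exact ((hs.measurePreserving ((jointLaw Q)[|transient ℓ])).prod
      (MeasurePreserving.id (envLaw Q))).map_eq.symm
  rw [← Measure.prod_prod, Measure.map_apply hφ (hA.prod hB)]
  have hmap : ((slabLaw Q ℓ).map (strip ℓ)).prod (envLaw Q) =
      ((slabLaw Q ℓ).prod (envLaw Q)).map fun p => (strip ℓ p.1, p.2) := by
    exact (((measurable_strip ℓ).measurePreserving (slabLaw Q ℓ)).prod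
      (MeasurePreserving.id (envLaw Q))).map_eq.symm
  have hσ : Measurable fun p : Slab d × Env d => (strip ℓ p.1, p.2) :=
    ((measurable_strip ℓ).comp measurable_fst).prodMk measurable_snd
  rw [hmap, Measure.map_apply hσ (hA.prod hB), hprod, Measure.map_apply hsV (hφ (hA.prod hB)),
    Measure.map_apply hsV (hσ (hA.prod hB))]
  have hae : ∀ᵐ q ∂((jointLaw Q)[|transient ℓ]).prod (envLaw Q), HasSlab ℓ q.1.2 :=
    Measure.quasiMeasurePreserving_fst.ae (ae_hasSlab Q ℓ hℓ)
  have hnull : ∀ S, (((jointLaw Q)[|transient ℓ]).prod (envLaw Q)) S =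
      (((jointLaw Q)[|transient ℓ]).prod (envLaw Q)) (S ∩ {q | HasSlab ℓ q.1.2}) := fun S =>
    (measure_inter_conull hae).symm
  -- Conditioning is a restriction up to a constant factor, so it can be traded for the
  -- unconditioned law, with transience absorbed into the walk event `E`.
  have hcondprod : ((jointLaw Q)[|transient ℓ]).prod (envLaw Q) =
      (jointLaw Q (transient ℓ))⁻¹ •
        ((jointLaw Q).prod (envLaw Q)).restrict (transient ℓ ×ˢ Set.univ) := by
    rw [← Measure.prod_restrict, Measure.restrict_univ, ProbabilityTheory.cond,
      Measure.prod_smul_left]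
  have hT : MeasurableSet (transient (d := d) ℓ ×ˢ (Set.univ : Set (Env d))) :=
    (measurableSet_transient ℓ).prod MeasurableSet.univ
  rw [hnull, hnull ((fun q : (Env d × Path d) × Env d => (slab ℓ 0 q.1, q.2)) ⁻¹' _), hcondprod,
    Measure.smul_apply, Measure.smul_apply, Measure.restrict_apply' hT, Measure.restrict_apply' hT]
  congr 1
  -- The history has countably many values. Once it is fixed, and the two regeneration times are
  -- genuine, the stripped slab, its off-path sites and the translation are deterministic.
  refine measure_eq_of_forall_fiber (c := fun q => slabHistory ℓ q.1.2)
    (fun i => (measurable_snd.comp measurable_fst) (measurableSet_slabHistory ℓ i)) fun i => ?_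
  obtain ⟨n, m, g⟩ := i
  obtain ⟨h, rfl⟩ := frestrictLe_surjective m g
  let E : Set (Path d) := {X | slabHistory ℓ X = (n, ⟨m, past m h⟩)} ∩
    ({X | HasSlab ℓ X} ∩
      {X | Filter.Tendsto (fun n => level ℓ (X n)) Filter.atTop Filter.atTop})
  have hE : MeasurableSet E := (measurableSet_slabHistory ℓ _).inter
    ((measurableSet_hasSlab ℓ).inter (measurableSet_tendsto_level ℓ))
  have hE' : ∀ X ∈ E, regTime ℓ X 0 = n ∧ regTime ℓ X 1 = m ∧ X ∈ cyl m h ∧ n < m := by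
    rintro X ⟨hX, hslab, -⟩
    obtain ⟨h1, h2, h3⟩ := slabHistory_eq_iff.1 hX
    exact ⟨h1, h2, h3, h1 ▸ h2 ▸ hslab.2.2⟩
  by_cases hσA : pathSlab ℓ h n m ∈ A
  · classical
    have key := jointLaw_prod_piecewise Q (h n) (offPath ℓ (pathSlab ℓ h n m)) hE (fun X hX k => by
      obtain ⟨h1, h2, h3, h4⟩ := hE' X hX
      exact avoid_offPath h4 (h1 ▸ hX.2.1.1) (h2 ▸ hX.2.1.2.1) h3 k) hB
    convert key using 2
    · ext q
      constructor
      · rintro ⟨hq, ⟨⟨-, hqB⟩, hslab⟩, hT, -⟩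
        have hqE : q.1.2 ∈ E := ⟨hq, hslab, hT⟩
        obtain ⟨h1, h2, h3, h4⟩ := hE' _ hqE
        refine ⟨hqE, ?_⟩
        rw [← resample_slab q.2 h4.le h1 h2 h3]
        exact hqB
      · rintro ⟨hqE, hqB⟩
        obtain ⟨h1, h2, h3, h4⟩ := hE' _ hqE
        refine ⟨hqE.1, ⟨⟨?_, ?_⟩, hqE.2.1⟩, hqE.2.2, trivial⟩
        · change strip ℓ (slab ℓ 0 q.1) ∈ A
          rwa [strip_slab h4.le h1 h2 h3]
        · change resample ℓ (slab ℓ 0 q.1, q.2) ∈ B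
          rwa [resample_slab q.2 h4.le h1 h2 h3]
    · ext q
      constructor
      · rintro ⟨hq, ⟨⟨-, hqB⟩, hslab⟩, hT, -⟩
        exact ⟨⟨hq, hslab, hT⟩, hqB⟩
      · rintro ⟨hqE, hqB⟩
        obtain ⟨h1, h2, h3, h4⟩ := hE' _ hqE
        refine ⟨hqE.1, ⟨⟨?_, hqB⟩, hqE.2.1⟩, hqE.2.2, trivial⟩
        change strip ℓ (slab ℓ 0 q.1) ∈ A
        rwa [strip_slab h4.le h1 h2 h3]
  · have hempty : ∀ q : (Env d × Path d) × Env d, slabHistory ℓ q.1.2 = (n, ⟨m, past m h⟩) →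
        HasSlab ℓ q.1.2 → q.1 ∈ transient ℓ → strip ℓ (slab ℓ 0 q.1) ∉ A := by
      intro q hq hslab hT
      obtain ⟨h1, h2, h3, h4⟩ := hE' _ ⟨hq, hslab, hT⟩
      rwa [strip_slab h4.le h1 h2 h3]
    refine (congrArg _ (Set.eq_empty_of_forall_notMem fun q hq => ?_)).trans
      (congrArg _ (Set.eq_empty_of_forall_notMem fun q hq => ?_)).symm
    · exact hempty q hq.1 hq.2.1.2 hq.2.2.1 hq.2.1.1.1
    · exact hempty q hq.1 hq.2.1.2 hq.2.2.1 hq.2.1.1.1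

/-- The two properties that make glued slabs tile the lattice. -/
theorem ae_slabLaw (ℓ : Dir d) (hℓ : 0 < jointLaw Q (transient ℓ)) :
    ∀ᵐ S ∂slabLaw Q ℓ, 0 < S.L ∧ level ℓ (S.K S.u) = S.L := by
  have hK : Measurable fun S : Slab d => S.K S.u :=
    measurable_of_countable_index (f := fun t (S : Slab d) => S.K t) measurable_slab_K
      measurable_slab_u
  have hm : MeasurableSet {S : Slab d | 0 < S.L ∧ level ℓ (S.K S.u) = S.L} :=
    (measurableSet_lt measurable_const measurable_slab_L).inter
      (measurableSet_eq_fun ((measurable_level ℓ).comp hK) measurable_slab_L)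
  rw [slabLaw, ae_map_iff (measurable_slab ℓ 0).aemeasurable hm]
  filter_upwards [ae_hasSlab Q ℓ hℓ] with p hp
  have h1 := hp.1.2 _ hp.2.2
  have h2 : regTime ℓ p.2 0 + (regTime ℓ p.2 1 - regTime ℓ p.2 0) = regTime ℓ p.2 1 :=
    Nat.add_sub_cancel' hp.2.2.le
  simp only [slab, Slab.L, Slab.K, Slab.u, zero_add, min_self, h2, level_sub]
  exact ⟨by omega, trivial⟩

end Resampling


/-! ### Gluing the resampled slabs -/

section Gluing

variable {d : ℕ}

/-- The anchor levels increase by the widths, which are integers at least `1`. They are thus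
unbounded in both directions and cut `ℤ` into consecutive half-open intervals; the index sought is
the greatest one whose anchor level does not exceed that of `z`. -/
theorem existsUnique_inSlab {ℓ : Dir d} {S : ℤ → Slab d}
    (hS : ∀ n, 0 < (S n).L ∧ level ℓ ((S n).K (S n).u) = (S n).L) (z : Site d) :
    ∃! n : ℤ, InSlab ℓ S z n := by
  let a : ℤ → ℤ := fun n => level ℓ (anchor S n)
  have hstep : ∀ n, a (n + 1) = a n + (S n).L := fun n => by
    simp only [a, anchor_add_one, level_add, (hS n).2]
  have hmono : StrictMono a := strictMono_int_of_lt_succ fun n => by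
    have := (hS n).1
    have := hstep n
    omega
  have hiff : ∀ n, InSlab ℓ S z n ↔ a n ≤ level ℓ z ∧ level ℓ z < a (n + 1) := fun n => by
    have := hstep n
    simp only [InSlab, slabSet, Set.mem_ofPred_eq, level_sub, a] at *
    omega
  have ha0 : a 0 = 0 := by simp [a, anchor_zero, level]
  have hpos : ∀ k : ℕ, (k : ℤ) ≤ a k := fun k => by
    induction k with
    | zero => simp [ha0]
    | succ k ih =>
      have := hstep k
      have := (hS k).1
      push_cast
      omega
  have hneg : ∀ k : ℕ, a (-k) ≤ -k := fun k => by
    induction k with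
    | zero => simp [ha0]
    | succ k ih =>
      have h1 := hstep (-(k + 1))
      have h2 := (hS (-(k + 1))).1
      rw [show -((k : ℤ) + 1) + 1 = -k by ring] at h1
      push_cast
      omega
  obtain ⟨n, hn, hmax⟩ := Int.exists_greatest_of_bdd (P := fun n => a n ≤ level ℓ z)
    ⟨(level ℓ z).natAbs, fun n hn => by
      by_contra hc
      have h1 := hmono (not_le.1 hc)
      have h2 := hpos (level ℓ z).natAbs
      omega⟩
    ⟨-((level ℓ z).natAbs : ℤ), by
      have := hneg (level ℓ z).natAbs
      omega⟩
  refine ⟨n, (hiff n).2 ⟨hn, ?_⟩, fun m hm => ?_⟩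
  · by_contra hc
    have := hmax (n + 1) (not_lt.1 hc)
    omega
  · obtain ⟨h1, h2⟩ := (hiff m).1 hm
    refine le_antisymm (hmax m h1) ?_
    have := hmono.lt_iff_lt.1 (hn.trans_lt h2)
    omega

/-- The environment `z ↦ V_{n(z)}(z - Y_{n(z)})`. -/
noncomputable def glue (ℓ : Dir d) (S : ℤ → Slab d) (V : ℤ → Env d) : Env d :=
  fun z => V (slabIndex ℓ S z) (z - anchor S (slabIndex ℓ S z))

theorem measurable_glue (ℓ : Dir d) :
    Measurable fun p : (ℤ → Slab d) × (ℤ → Env d) => glue ℓ p.1 p.2 := by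
  refine measurable_pi_iff.2 fun z => ?_
  refine measurable_of_countable_index
    (f := fun n (p : (ℤ → Slab d) × (ℤ → Env d)) => p.2 n (z - anchor p.1 n)) (fun n => ?_)
    ((measurable_slabIndex ℓ z).comp measurable_fst)
  exact measurable_of_countable_index
    (f := fun y (p : (ℤ → Slab d) × (ℤ → Env d)) => p.2 n y) (fun y => by fun_prop)
    (((measurable_anchor n).comp measurable_fst).const_sub z)

/-- Gluing pieces of independent i.i.d. environments along fixed slabs yields an i.i.d.
environment. -/
theorem measurePreserving_glue (Q : Measure (StepLaw d)) [IsProbabilityMeasure Q] (ℓ : Dir d)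
    (S : ℤ → Slab d) :
    MeasurePreserving (glue ℓ S) (Measure.infinitePi fun _ : ℤ => envLaw Q) (envLaw Q) := by
  -- The coordinate read at `z`. Index and offset determine `z` even where `slabIndex` takes its
  -- default value, so no tiling assumption is needed.
  let f : Site d → ℤ × Site d := fun z => (slabIndex ℓ S z, z - anchor S (slabIndex ℓ S z))
  have hf : Function.Injective f := fun z z' h => by
    obtain ⟨h1, h2⟩ := Prod.mk.inj h
    rw [h1] at h2
    exact sub_left_injective h2
  have h := measurePreserving_comp_injective Q hf
  have hcurry := Measure.infinitePi_map_curry_symm fun (_ : ℤ) (_ : Site d) => Q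
  have := h.comp ⟨(MeasurableEquiv.curry ℤ (Site d) (StepLaw d)).symm.measurable, hcurry⟩
  exact this

theorem measurableSet_eq_off (z : Site d) : MeasurableSet
    {p : Env d × Env d × Set (Site d) | z ∉ p.2.2 → p.1 z = p.2.1 z} := by
  have h1 : MeasurableSet {p : Env d × Env d × Set (Site d) | z ∈ p.2.2} :=
    measurableSet_setOfPred.2 ((measurable_set_mem z).comp (measurable_snd.comp measurable_snd))
  have h2 : MeasurableSet {p : Env d × Env d × Set (Site d) | p.1 z = p.2.1 z} := by
    have : {p : Env d × Env d × Set (Site d) | p.1 z = p.2.1 z} =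
        ⋂ e : Dir d, {p | (p.1 z).1 e = (p.2.1 z).1 e} := by
      ext p
      simp [Subtype.ext_iff, funext_iff]
    rw [this]
    exact MeasurableSet.iInter fun e => measurableSet_eq_fun
      ((measurable_pi_apply e).comp (measurable_subtype_coe.comp
        ((measurable_pi_apply z).comp measurable_fst)))
      ((measurable_pi_apply e).comp (measurable_subtype_coe.comp
        ((measurable_pi_apply z).comp (measurable_fst.comp measurable_snd))))
  have : {p : Env d × Env d × Set (Site d) | z ∉ p.2.2 → p.1 z = p.2.1 z} =
      {p | z ∈ p.2.2} ∪ {p | p.1 z = p.2.1 z} := by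
    ext p
    simp [imp_iff_not_or]
  rw [this]
  exact h1.union h2

/-- Relative to its slab, a site off the glued path lies in `offPath`, where resampling keeps the
slab's environment. -/
theorem glue_resample_eq {ℓ : Dir d} {x : ℤ → Slab d × Env d} {z : Site d}
    (h : ∃! n : ℤ, InSlab ℓ (fun n => (x n).1) z n) (hz : z ∉ gluedPath fun n => (x n).1) :
    glue ℓ (fun n => (x n).1) (fun n => resample ℓ (x n)) z =
      gluedEnv ℓ (fun n => (x n).1) z := by
  have hin : InSlab ℓ (fun n => (x n).1) z (slabIndex ℓ (fun n => (x n).1) z) := by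
    rw [slabIndex, dif_pos h]
    exact h.choose_spec.1
  rw [gluedEnv, if_pos h, glue, resample, Set.piecewise_eq_of_mem]
  refine ⟨hin, fun t ht hK => hz ?_⟩
  refine Set.mem_iUnion.2 ⟨slabIndex ℓ (fun n => (x n).1) z, t, ⟨Nat.zero_le t, ht⟩, ?_⟩
  simp only [hK, add_sub_cancel]

/-- The stripped slabs and the environment glued from the resampled slabs are independent, and
the latter is i.i.d. -/
theorem measurePreserving_strip_glue (Q : Measure (StepLaw d)) [IsProbabilityMeasure Q]
    (ℓ : Dir d) (hℓ : 0 < jointLaw Q (transient ℓ)) :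
    MeasurePreserving (fun x : ℤ → Slab d × Env d => ((fun n => strip ℓ (x n).1),
        glue ℓ (fun n => (x n).1) (fun n => resample ℓ (x n))))
      (Measure.infinitePi fun _ : ℤ => (slabLaw Q ℓ).prod (envLaw Q))
      ((Measure.infinitePi fun _ : ℤ => (slabLaw Q ℓ).map (strip ℓ)).prod (envLaw Q)) := by
  have hlaw := isProbabilityMeasure_slabLaw Q ℓ hℓ
  have hstrip := Measure.isProbabilityMeasure_map (μ := slabLaw Q ℓ)
    (measurable_strip ℓ).aemeasurable
  have hpi := measurePreserving_infinitePi (ι := ℤ) (measurePreserving_resample Q ℓ hℓ)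
  have hunzip : MeasurePreserving
      (fun x : ℤ → Slab d × Env d => ((fun n => (x n).1), fun n => (x n).2))
      (Measure.infinitePi fun _ : ℤ => ((slabLaw Q ℓ).map (strip ℓ)).prod (envLaw Q))
      ((Measure.infinitePi fun _ : ℤ => (slabLaw Q ℓ).map (strip ℓ)).prod
        (Measure.infinitePi fun _ : ℤ => envLaw Q)) := by
    have hz := measurePreserving_zip (ι := ℤ) ((slabLaw Q ℓ).map (strip ℓ)) (envLaw Q)
    refine ⟨by fun_prop, ?_⟩
    rw [← hz.map_eq, Measure.map_map (by fun_prop) hz.measurable]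
    exact Measure.map_id
  have hglue : MeasurePreserving
      (fun p : (ℤ → Slab d) × (ℤ → Env d) => (p.1, glue ℓ p.1 p.2))
      ((Measure.infinitePi fun _ : ℤ => (slabLaw Q ℓ).map (strip ℓ)).prod
        (Measure.infinitePi fun _ : ℤ => envLaw Q))
      ((Measure.infinitePi fun _ : ℤ => (slabLaw Q ℓ).map (strip ℓ)).prod (envLaw Q)) :=
    (MeasurePreserving.id _).skew_product (measurable_glue ℓ)
      (ae_of_all _ fun S => (measurePreserving_glue Q ℓ S).map_eq)
  -- Stripping changes neither widths nor paths, so `glue` gives definitionally the same result for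
  -- the stripped slabs as for the original ones.
  exact hglue.comp (hunzip.comp hpi)

/-- The triple of the glued resampled environment, the glued environment and the glued path. -/
noncomputable def couple (ℓ : Dir d) (x : ℤ → Slab d × Env d) : Env d × Env d × Set (Site d) :=
  (glue ℓ (fun n => (x n).1) (fun n => resample ℓ (x n)),
    gluedEnv ℓ (fun n => (x n).1), gluedPath fun n => (x n).1)

theorem measurable_couple (ℓ : Dir d) : Measurable (couple (d := d) ℓ) := by
  have h1 : Measurable fun (x : ℤ → Slab d × Env d) n => (x n).1 := by fun_prop
  have h2 : Measurable fun (x : ℤ → Slab d × Env d) n => resample ℓ (x n) :=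
    measurable_pi_iff.2 fun n => (measurable_resample ℓ).comp (measurable_pi_apply n)
  exact ((measurable_glue ℓ).comp (h1.prodMk h2)).prodMk
    (((measurable_gluedEnv ℓ).comp h1).prodMk (measurable_gluedPath.comp h1))

/-- The law of an i.i.d. sequence of slabs with independent i.i.d. environments. -/
noncomputable def slabsLaw (Q : Measure (StepLaw d)) [IsProbabilityMeasure Q] (ℓ : Dir d)
    [IsProbabilityMeasure (slabLaw Q ℓ)] : Measure (ℤ → Slab d × Env d) :=
  Measure.infinitePi fun _ : ℤ => (slabLaw Q ℓ).prod (envLaw Q)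

section Couple

variable (Q : Measure (StepLaw d)) [IsProbabilityMeasure Q] (ℓ : Dir d)
  [IsProbabilityMeasure (slabLaw Q ℓ)]

instance : IsProbabilityMeasure (slabsLaw Q ℓ) := by unfold slabsLaw; infer_instance

theorem map_couple_snd :
    (slabsLaw Q ℓ).map (fun x => (couple ℓ x).2) = backwardPathLaw Q ℓ := by
  have h1 := measurePreserving_infinitePi (ι := ℤ)
    (measurePreserving_fst (μ := slabLaw Q ℓ) (ν := envLaw Q))
  have hG : Measurable fun S : ℤ → Slab d => (gluedEnv ℓ S, gluedPath S) :=
    (measurable_gluedEnv ℓ).prodMk measurable_gluedPath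
  rw [backwardPathLaw, ← h1.map_eq, Measure.map_map hG h1.measurable]
  rfl

theorem ae_couple (hℓ : 0 < jointLaw Q (transient ℓ)) :
    ∀ᵐ x ∂slabsLaw Q ℓ, ∀ z, z ∉ (couple ℓ x).2.2 → (couple ℓ x).1 z = (couple ℓ x).2.1 z := by
  have hgood : ∀ᵐ x ∂slabsLaw Q ℓ, ∀ n : ℤ,
      0 < (x n).1.L ∧ level ℓ ((x n).1.K (x n).1.u) = (x n).1.L := by
    refine ae_all_iff.2 fun n => ?_
    have hev := measurePreserving_fst.comp (measurePreserving_eval_infinitePi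
      (fun _ : ℤ => (slabLaw Q ℓ).prod (envLaw Q)) n)
    exact hev.quasiMeasurePreserving.ae (ae_slabLaw Q ℓ hℓ)
  filter_upwards [hgood] with x hx
  exact fun z hz => glue_resample_eq (existsUnique_inSlab hx z) hz

/-- The first environment of the coupling is i.i.d. and independent of the path. -/
theorem exists_measurePreserving_couple (hℓ : 0 < jointLaw Q (transient ℓ)) :
    ∃ T : Measure (Set (Site d)), IsProbabilityMeasure T ∧
      MeasurePreserving (fun x => ((couple ℓ x).1, (couple ℓ x).2.2)) (slabsLaw Q ℓ)
        ((envLaw Q).prod T) := by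
  have hstrip := Measure.isProbabilityMeasure_map (μ := slabLaw Q ℓ)
    (measurable_strip ℓ).aemeasurable
  have hm := measurable_couple (d := d) ℓ
  let R := Measure.infinitePi fun _ : ℤ => (slabLaw Q ℓ).map (strip ℓ)
  have hT := Measure.isProbabilityMeasure_map (μ := R) (measurable_gluedPath (d := d)).aemeasurable
  refine ⟨R.map gluedPath, hT, hm.fst.prodMk hm.snd.snd, ?_⟩
  have hJ := measurePreserving_strip_glue Q ℓ hℓ
  have hS := Measure.measurePreserving_swap (μ := R) (ν := envLaw Q)
  have hP := (MeasurePreserving.id (envLaw Q)).prod (measurable_gluedPath.measurePreserving R)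
  -- The glued path is definitionally the same for stripped slabs, which are independent of the
  -- glued environment.
  exact (hP.comp (hS.comp hJ)).map_eq

end Couple

end Gluing

end RWRE

/-! ### The coupling -/

open RWRE in
theorem proposition3p1 {d : ℕ} (Q : MeasureTheory.Measure (RWRE.StepLaw d))
    [MeasureTheory.IsProbabilityMeasure Q] (hQ : RWRE.UniformlyElliptic Q)
    (ℓ : RWRE.Dir d) (hℓ : 0 < RWRE.jointLaw Q (RWRE.transient ℓ)) :
    ∃ Pt : MeasureTheory.Measure (RWRE.Env d × RWRE.Env d × Set (RWRE.Site d)),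
      MeasureTheory.IsProbabilityMeasure Pt ∧
      Pt.map (fun p => p.1) = RWRE.envLaw Q ∧
      Pt.map (fun p => p.2) = RWRE.backwardPathLaw Q ℓ ∧
      (∀ᵐ p ∂Pt, ∀ z : RWRE.Site d, z ∉ p.2.2 → p.1 z = p.2.1 z) ∧
      ProbabilityTheory.IndepFun (fun p => p.1) (fun p => p.2.2) Pt := by
  have hlaw := isProbabilityMeasure_slabLaw Q ℓ hℓ
  have hm := measurable_couple (d := d) ℓ
  obtain ⟨T, hT, hJ⟩ := exists_measurePreserving_couple Q ℓ hℓ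
  have hfst : (slabsLaw Q ℓ).map (fun x => (couple ℓ x).1) = envLaw Q :=
    (measurePreserving_fst.comp hJ).map_eq
  have hpath : (slabsLaw Q ℓ).map (fun x => (couple ℓ x).2.2) = T :=
    (measurePreserving_snd.comp hJ).map_eq
  refine ⟨(slabsLaw Q ℓ).map (couple ℓ), Measure.isProbabilityMeasure_map hm.aemeasurable,
    ?_, ?_, ?_, ?_⟩
  · rw [Measure.map_map measurable_fst hm]
    exact hfst
  · rw [Measure.map_map measurable_snd hm]
    exact map_couple_snd Q ℓ
  · refine ae_all_iff.2 fun z => (ae_map_iff hm.aemeasurable (measurableSet_eq_off z)).2 ?_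
    filter_upwards [ae_couple Q ℓ hℓ] with x hx using hx z
  · have hm2 : Measurable fun p : Env d × Env d × Set (Site d) => p.2.2 :=
      measurable_snd.comp measurable_snd
    have := Measure.isProbabilityMeasure_map (μ := slabsLaw Q ℓ) hm.aemeasurable
    refine (indepFun_iff_map_prod_eq_prod_map_map measurable_fst.aemeasurable
      hm2.aemeasurable).2 ?_
    rw [Measure.map_map (measurable_fst.prodMk hm2) hm, Measure.map_map measurable_fst hm,
      Measure.map_map hm2 hm]
    exact hJ.map_eq.trans (congrArg₂ Measure.prod hfst.symm hpath.symm)
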